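/- Let $n$ be a positive integer, let $B\subseteq\mathbb R^n$ be a domain (nonempty, open and connected), let $T_B=\mathbb R^n+iB\subseteq\mathbb C^n$ be the tube over $B$, let $\psi:B\to\mathbb R$ be continuous, and write $t\cdot z=t_1z_1+\dots+t_nz_n$. For $1\le p<\infty$ and $0<s\le\infty$, let $A^{p,s}(B,\psi)$ be the set of functions $F$ holomorphic in $T_B$ with $\|F\|_{A^{p,s}(B,\psi)}<\infty$, where $$\|F\|_{A^{p,s}(B,\psi)}=\Big(\int_B\Big(\int_{\mathbb R^n}\big|F(x+iy)e^{-2\pi\psi(y)}\big|^p\,dx\Big)^s dy\Big)^{\frac1{sp}}\quad(s<\infty),$$ $$\|F\|_{A^{p,\infty}(B,\psi)}=\sup_{y\in B}e^{-2\pi\psi(y)}\Big(\int_{\mathbb R^n}|F(x+iy)|^p\,dx\Big)^{\frac1p}.$$ For $0<\alpha<\infty$ put $U_\alpha(B,\psi)=\{t\in\mathbb R^n:\int_Be^{-2\pi\alpha(t\cdot y+\psi(y))}\,dy<\infty\}$, and put $U_\infty(B,\psi)=\{t\in\mathbb R^n:\inf_{y\in B}(t\cdot y+\psi(y))>-\infty\}$.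 **Theorem 1.** Let $1\le p\le2$, $0<s\le\infty$ and $F\in A^{p,s}(B,\psi)$. Then there is a function $f:\mathbb R^n\to\mathbb C$ such that, for every $z\in T_B$, the function $t\mapsto f(t)e^{2\pi i\,t\cdot z}$ is integrable on $\mathbb R^n$ and $$F(z)=\int_{\mathbb R^n}f(t)e^{2\pi i\,t\cdot z}\,dt ,$$ and $f$ has the following properties. 1. If $p=1$, then $f$ is continuous on $\mathbb R^n$, for every $t\in\mathbb R^n$ $$|f(t)|\Big(\int_Be^{-2\pi s(y\cdot t+\psi(y))}\,dy\Big)^{\frac1s}\le\|F\|_{A^{1,s}(B,\psi)}$$ (with $0\cdot\infty=0$; for $s=\infty$ the second factor is $\sup_{y\in B}e^{-2\pi(y\cdot t+\psi(y))}$), and $f(t)=0$ for every $t\notin U_s(B,\psi)$. 2. If $1<p\le2$ and $\frac1p+\frac1q=1$, then $f$ is measurable and $$\Big(\int_B\Big(\int_{\mathbb R^n}\big|f(t)e^{-2\pi(y\cdot t+\psi(y))}\big|^q\,dt\Big)^{\frac{sp}q}dy\Big)^{\frac1{sp}}\le\|F\|_{A^{p,s}(B,\psi)}$$ (for $s=\infty$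 the left-hand side is $\sup_{y\in B}\big(\int_{\mathbb R^n}|f(t)e^{-2\pi(y\cdot t+\psi(y))}|^q\,dt\big)^{1/q}$). If moreover $0<s(p-1)\le1$, then $f(t)=0$ for every $t\notin U_{sp}(B,\psi)$. -/

import Mathlib

open MeasureTheory
open scoped ENNReal

noncomputable section

namespace TubeBergman

/-- The point `x + i y` of `ℂⁿ`. -/
def cpoint {n : ℕ} (x y : EuclideanSpace ℝ (Fin n)) : EuclideanSpace ℂ (Fin n) :=
  WithLp.toLp 2 fun j => (x j : ℂ) + (y j : ℂ) * Complex.I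

/-- The tube `T_B = ℝⁿ + i B`. -/
def tube {n : ℕ} (B : Set (EuclideanSpace ℝ (Fin n))) : Set (EuclideanSpace ℂ (Fin n)) :=
  {z | ∃ x : EuclideanSpace ℝ (Fin n), ∃ y ∈ B, z = cpoint x y}

/-- The bilinear product `t · z = t₁ z₁ + ⋯ + tₙ zₙ` of `t ∈ ℝⁿ` and `z ∈ ℂⁿ`. -/
def dot {n : ℕ} (t : EuclideanSpace ℝ (Fin n)) (z : EuclideanSpace ℂ (Fin n)) : ℂ :=
  ∑ j, (t j : ℂ) * z j

/-- The (extended) norm of `A^{p,s}(B, ψ)`, for `0 < p < ∞` and `0 < s ≤ ∞`. -/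
def bergmanNorm {n : ℕ} (B : Set (EuclideanSpace ℝ (Fin n))) (ψ : EuclideanSpace ℝ (Fin n) → ℝ)
    (p : ℝ) (s : ℝ≥0∞) (F : EuclideanSpace ℂ (Fin n) → ℂ) : ℝ≥0∞ :=
  if s = ∞ then
    ⨆ y ∈ B, ENNReal.ofReal (Real.exp (-2 * Real.pi * ψ y)) *
      (∫⁻ x, ‖F (cpoint x y)‖ₑ ^ p) ^ (1 / p)
  else
    (∫⁻ y in B, (∫⁻ x, (‖F (cpoint x y)‖ₑ *
      ENNReal.ofReal (Real.exp (-2 * Real.pi * ψ y))) ^ p) ^ s.toReal) ^ (1 / (s.toReal * p))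

/-- The space `A^{p,s}(B, ψ)`: functions holomorphic in `T_B` of finite norm. -/
def bergmanSpace {n : ℕ} (B : Set (EuclideanSpace ℝ (Fin n))) (ψ : EuclideanSpace ℝ (Fin n) → ℝ)
    (p : ℝ) (s : ℝ≥0∞) : Set (EuclideanSpace ℂ (Fin n) → ℂ) :=
  {F | DifferentiableOn ℂ F (tube B) ∧ bergmanNorm B ψ p s F < ∞}

/-- The set `U_α(B, ψ)` for `0 < α ≤ ∞`. -/
def weightSet {n : ℕ} (B : Set (EuclideanSpace ℝ (Fin n))) (ψ : EuclideanSpace ℝ (Fin n) → ℝ)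
    (α : ℝ≥0∞) : Set (EuclideanSpace ℝ (Fin n)) :=
  if α = ∞ then
    {t | BddBelow ((fun y => inner ℝ t y + ψ y) '' B)}
  else
    {t | ∫⁻ y in B, ENNReal.ofReal
      (Real.exp (-2 * Real.pi * α.toReal * (inner ℝ t y + ψ y))) < ∞}

/-- `(∫_B e^{-2πs(y·t + ψ(y))} dy)^{1/s}`, read as the supremum over `y ∈ B` of
`e^{-2π(y·t + ψ(y))}` if `s = ∞`. -/
def weightNorm {n : ℕ} (B : Set (EuclideanSpace ℝ (Fin n))) (ψ : EuclideanSpace ℝ (Fin n) → ℝ)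
    (s : ℝ≥0∞) (t : EuclideanSpace ℝ (Fin n)) : ℝ≥0∞ :=
  if s = ∞ then
    ⨆ y ∈ B, ENNReal.ofReal (Real.exp (-2 * Real.pi * (inner ℝ y t + ψ y)))
  else
    (∫⁻ y in B, ENNReal.ofReal
      (Real.exp (-2 * s.toReal * Real.pi * (inner ℝ y t + ψ y)))) ^ (1 / s.toReal)

/-- `(∫_B (∫ |f(t) e^{-2π(y·t + ψ(y))}|^q dt)^{sp/q} dy)^{1/(sp)}`, with the supremum over `y ∈ B`
of the `L^q` norms if `s = ∞`. -/
def mixedNorm {n : ℕ} (B : Set (EuclideanSpace ℝ (Fin n))) (ψ : EuclideanSpace ℝ (Fin n) → ℝ)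
    (p q : ℝ) (s : ℝ≥0∞) (f : EuclideanSpace ℝ (Fin n) → ℂ) : ℝ≥0∞ :=
  if s = ∞ then
    ⨆ y ∈ B, (∫⁻ t, (‖f t‖ₑ *
      ENNReal.ofReal (Real.exp (-2 * Real.pi * (inner ℝ y t + ψ y)))) ^ q) ^ (1 / q)
  else
    (∫⁻ y in B, (∫⁻ t, (‖f t‖ₑ *
      ENNReal.ofReal (Real.exp (-2 * Real.pi * (inner ℝ y t + ψ y)))) ^ q) ^
        (s.toReal * p / q)) ^ (1 / (s.toReal * p))

end TubeBergman

end

open TubeBergman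

open scoped FourierTransform

namespace TubeBergman

/-! The function `f` ought to be `e^{2π t·y}` times the Fourier transform of the slice `x ↦ F(x +
iy)`. By Cauchy's theorem this product should not depend on `y`, so Fourier inversion on any slice
represents `F`. The trivial `L¹ → L^∞` bound (`p = 1`) or the Hausdorff–Young inequality
`lintegral_fourier_rpow_le` (`1 < p ≤ 2`) on each slice gives the norm estimate once integrated in
`y`.

Two things are missing at the start: slices need not decay pointwise, and finiteness of the norm
makes slices `p`-integrable only for `y` in a dense set `S`. For the first, a sub-mean-value
inequality for `|F|^σ` with `σ ≤ 1` (small exponents are forced by small `s`) shows in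
`exists_norm_slice_le` that `F` is bounded on tubes over small balls. Then `F(z) e^{-ε z·z}` has
Gaussian decay in `x`, and for such functions independence of the slice
(`HasGaussianDecay.sliceTransform_eq`) and inversion hold.

It remains to let `ε → 0`. The transforms converge pointwise on slices over `S` if `p = 1`, and in a
weighted `L^q` if `p > 1`. To represent `F` at an arbitrary `y`, `exists_finset_exp_inner_le` bounds
`e^{-2π t·y}` by `e^{-c|t|}` times a finite sum of `e^{-2π t·y'}` with `y' ∈ S`; estimates on `S`
thus pass to `y` with an exponentially decaying factor to spare.

Support: for `p = 1` the pointwise estimate makes the weight integral finite wherever `f(t) ≠ 0`.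
For `p > 1` the condition `s(p - 1) ≤ 1` says `sp ≤ q`, so the outer exponent `sp/q` is at most `1`.
Hölder on sets of finite measure where `|f|` is bounded below then makes the weight integral finite
for almost every `t` with `f(t) ≠ 0`, and `f` is changed on a null set. -/

theorem differentiableOn_integral_of_dominated {α : Type*} [MeasurableSpace α] {μ : Measure α}
    {U : Set ℂ} (hU : IsOpen U) {φ : ℂ → α → ℂ} {b : α → ℝ}
    (hm : ∀ z ∈ U, AEStronglyMeasurable (φ z) μ)
    (hd : ∀ a, DifferentiableOn ℂ (fun z => φ z a) U)
    (hb : ∀ z ∈ U, ∀ a, ‖φ z a‖ ≤ b a) (hbi : Integrable b μ) :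
    DifferentiableOn ℂ (fun z => ∫ a, φ z a ∂μ) U := by
  intro z₀ hz₀
  obtain ⟨R', hR', hsub'⟩ := Metric.isOpen_iff.1 hU z₀ hz₀
  -- With `2R < R'`, closed discs of radius `R` about points of `ball z₀ R` stay in `U`, so Cauchy's
  -- estimate bounds the derivative by `b a / R` there.
  obtain ⟨R, hR, hRR⟩ : ∃ R, 0 < R ∧ 2 * R < R' := ⟨R' / 4, by positivity, by linarith⟩
  have hcl : ∀ z ∈ Metric.ball z₀ R, Metric.closedBall z R ⊆ U := fun z hz w hw => hsub' <| by
    rw [Metric.mem_ball] at *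
    rw [Metric.mem_closedBall] at hw
    linarith [dist_triangle w z z₀]
  have hda : ∀ z ∈ U, ∀ a, HasDerivAt (fun z => φ z a) (deriv (fun z => φ z a) z) z :=
    fun z hz a => ((hd a).differentiableAt (hU.mem_nhds hz)).hasDerivAt
  have hballU : Metric.ball z₀ R ⊆ U := fun z hz => hcl z hz (Metric.mem_closedBall_self hR.le)
  refine DifferentiableAt.differentiableWithinAt ?_
  refine (hasDerivAt_integral_of_dominated_loc_of_deriv_le (μ := μ) (F := φ) (𝕜 := ℂ)
    (F' := fun z a => deriv (fun z => φ z a) z) (bound := fun a => b a / R)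
    (Metric.ball_mem_nhds z₀ hR) ?_ ?_ ?_ ?_ (hbi.div_const R) ?_).2.differentiableAt
  · filter_upwards [hU.mem_nhds hz₀] with z hz using hm z hz
  · exact hbi.mono' (hm _ hz₀) (.of_forall (hb _ hz₀))
  -- The derivative is measurable in `a` as a limit of difference quotients with increments `R / (n
  -- + 2)`; starting the denominators at `2` keeps the points inside the open ball.
  · have hu : Filter.Tendsto (fun n : ℕ => (R : ℂ) * (1 / ((n : ℂ) + 2))) Filter.atTop
        (nhdsWithin 0 {0}ᶜ) := by
      refine tendsto_nhdsWithin_iff.2 ⟨?_, .of_forall fun n => ?_⟩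
      · have h := (tendsto_one_div_add_atTop_nhds_zero_nat (𝕜 := ℂ)).comp
          (Filter.tendsto_add_atTop_nat 1)
        have := h.const_mul (R : ℂ)
        rw [mul_zero] at this
        refine this.congr fun n => ?_
        simp only [Function.comp_apply, Nat.cast_add, Nat.cast_one]
        ring
      · have : ((n : ℂ) + 2) ≠ 0 := by exact_mod_cast (by omega : n + 2 ≠ 0)
        simp [this, hR.ne']
    refine aestronglyMeasurable_of_tendsto_ae (Filter.atTop : Filter ℕ)
      (f := fun (n : ℕ) a => ((R : ℂ) * (1 / ((n : ℂ) + 2)))⁻¹ •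
        (φ (z₀ + (R : ℂ) * (1 / ((n : ℂ) + 2))) a - φ z₀ a)) (fun n => ?_) (.of_forall fun a => ?_)
    · refine ((hm _ (hballU ?_)).sub (hm _ hz₀)).const_smul (_ : ℂ)
      rw [Metric.mem_ball, dist_eq_norm, add_sub_cancel_left, norm_mul, Complex.norm_real,
        Real.norm_of_nonneg hR.le]
      have : ‖(1 / ((n : ℂ) + 2))‖ < 1 := by
        rw [norm_div, norm_one, div_lt_one]
        · rw [show (n : ℂ) + 2 = ((n + 2 : ℕ) : ℂ) by push_cast; rfl, Complex.norm_natCast]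
          push_cast
          linarith [(Nat.cast_nonneg n : (0 : ℝ) ≤ n)]
        · rw [show (n : ℂ) + 2 = ((n + 2 : ℕ) : ℂ) by push_cast; rfl, Complex.norm_natCast]
          positivity
      nlinarith
    · exact (hasDerivAt_iff_tendsto_slope_zero.1 (hda z₀ hz₀ a)).comp hu
  · refine .of_forall fun a z hz => ?_
    refine Complex.norm_deriv_le_of_forall_mem_sphere_norm_le hR ?_ fun w hw =>
      hb w (hcl z hz (Metric.sphere_subset_closedBall hw)) a
    exact ((hd a).mono (hcl z hz)).diffContOnCl_ball subset_rfl
  · exact .of_forall fun a z hz => hda z (hballU hz) a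

/-- Hölder's inequality with exponents `1 / r` and `1 / (1 - r)` against the constant `1`. It is
used for the local bound on `F` and again for the support of `f`. -/
theorem lintegral_rpow_le_measure_rpow_mul {α : Type*} [MeasurableSpace α] {μ : Measure α}
    {r : ℝ} (hr : 0 < r) (hr1 : r ≤ 1) {h : α → ℝ≥0∞} (hh : AEMeasurable h μ) :
    ∫⁻ a, h a ^ r ∂μ ≤ μ Set.univ ^ (1 - r) * (∫⁻ a, h a ∂μ) ^ r := by
  rcases hr1.eq_or_lt with rfl | hr1
  · simp
  have hc : (1 / r).HolderConjugate (1 / (1 - r)) := by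
    rw [Real.holderConjugate_iff]
    refine ⟨by rw [lt_div_iff₀ hr]; linarith, by simp⟩
  have := ENNReal.lintegral_mul_le_Lp_mul_Lq μ hc (hh.pow_const r) (aemeasurable_const (b := 1))
  simp only [Pi.mul_apply, mul_one, ← ENNReal.rpow_mul, ENNReal.one_rpow, lintegral_const, one_mul,
    mul_one_div_cancel hr.ne', ENNReal.rpow_one, one_div_one_div] at this
  rwa [mul_comm]

/-! ### Sub-mean-value inequalities in several complex variables -/

section MeanValue

variable {V : Type*} [NormedAddCommGroup V] [NormedSpace ℂ V] [FiniteDimensional ℂ V]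
  [MeasurableSpace V] [BorelSpace V] (μ : Measure V) [μ.IsAddHaarMeasure]

/-- The image of `μ` is again a Haar measure, hence a multiple of `μ`; the unit ball is invariant,
so the factor is `1`. -/
theorem measurePreserving_smul_of_norm_eq_one {c : ℂ} (hc : ‖c‖ = 1) :
    MeasurePreserving (fun v : V => c • v) μ μ := by
  have : FiniteDimensional ℝ V := FiniteDimensional.complexToReal V
  have hc0 : c ≠ 0 := by rintro rfl; simp at hc
  have hcont : Continuous fun v : V => c • v := continuous_const_smul c
  refine ⟨hcont.measurable, ?_⟩
  let e : V ≃+ V := DistribMulAction.toAddEquiv₀ V c hc0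
  have he : (μ.map e).IsAddHaarMeasure :=
    e.isAddHaarMeasure_map μ hcont (continuous_const_smul c⁻¹)
  have h := Measure.isAddLeftInvariant_eq_smul (μ.map e) μ
  have hball : (μ.map e) (Metric.ball 0 1) = μ (Metric.ball 0 1) := by
    rw [Measure.map_apply (show Measurable e from hcont.measurable) measurableSet_ball]
    congr 1
    ext v
    have : e v = c • v := rfl
    simp [this, norm_smul, hc]
  rw [h, Measure.smul_apply] at hball
  change μ.map e = μ
  rw [h]
  have h0 : μ (Metric.ball 0 1) ≠ 0 := (Metric.measure_ball_pos μ 0 one_pos).ne'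
  have h1 : μ (Metric.ball 0 1) ≠ ∞ := measure_ball_lt_top.ne
  set k := Measure.addHaarScalarFactor (μ.map e) μ
  have : (k : ℝ≥0∞) = 1 := by
    rw [ENNReal.smul_def, smul_eq_mul] at hball
    exact (ENNReal.mul_eq_right h0 h1).1 hball
  have : k = 1 := by exact_mod_cast this
  rw [this, one_smul]

/-- For each `v` in the centred ball, `F z` is the mean of `F` over the circle `z + e^{iθ} v`.
Integrating over `v` and exchanging integrals gives the claim, since each rotation `v ↦ e^{iθ} v`
preserves both the ball and `μ`. -/
theorem enorm_mul_measure_ball_le_lintegral {F : V → ℂ} {z : V} {r : ℝ}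
    (hF : DifferentiableOn ℂ F (Metric.ball z r)) :
    ‖F z‖ₑ * μ (Metric.ball z r) ≤ ∫⁻ v in Metric.ball z r, ‖F v‖ₑ ∂μ := by
  classical
  have : FiniteDimensional ℝ V := FiniteDimensional.complexToReal V
  set G : V → ℂ := (Metric.ball z r).piecewise F 0 with hG
  have hGm : Measurable G :=
    hF.continuousOn.measurable_piecewise continuousOn_const measurableSet_ball
  have hGF : ∀ v ∈ Metric.ball z r, G v = F v := fun v hv => Set.piecewise_eq_of_mem _ _ _ hv
  have htrans : ∀ H : V → ℝ≥0∞, ∫⁻ v in Metric.ball z r, H v ∂μ =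
      ∫⁻ v in Metric.ball 0 r, H (z + v) ∂μ := fun H => by
    have h := (measurePreserving_add_left μ z).setLIntegral_comp_emb
      (MeasurableEquiv.addLeft z).measurableEmbedding H (Metric.ball 0 r)
    rw [h]
    congr 2
    simp
  have hcirc : ∀ θ, ‖circleMap 0 1 θ‖ = 1 := fun θ => by simp
  have hmem : ∀ v ∈ Metric.ball (0 : V) r, ∀ w : ℂ, ‖w‖ ≤ 1 → z + w • v ∈ Metric.ball z r := by
    intro v hv w hw
    rw [mem_ball_zero_iff] at hv
    rw [Metric.mem_ball, dist_eq_norm, add_sub_cancel_left, norm_smul]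
    nlinarith [norm_nonneg v]
  have hmean : ∀ v ∈ Metric.ball (0 : V) r, ‖F z‖ₑ ≤ ENNReal.ofReal (2 * Real.pi)⁻¹ *
      ∫⁻ θ in Set.Ioc 0 (2 * Real.pi), ‖G (z + circleMap 0 1 θ • v)‖ₑ := by
    intro v hv
    have hd : DifferentiableOn ℂ (fun w : ℂ => F (z + w • v)) (Metric.closedBall 0 1) := by
      refine hF.comp (by fun_prop) fun w hw => hmem v hv w (by simpa using hw)
    have h := (DifferentiableOn.diffContOnCl_ball hd (R := |1|) (c := 0)
      (by simp)).circleAverage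
    rw [Real.circleAverage, intervalIntegral.integral_of_le (by positivity)] at h
    simp only [zero_smul, add_zero] at h
    rw [← h, enorm_smul, Real.enorm_of_nonneg (by positivity)]
    gcongr
    refine (enorm_integral_le_lintegral_enorm _).trans (le_of_eq ?_)
    refine lintegral_congr fun θ => ?_
    rw [hGF _ (hmem v hv _ (hcirc θ).le)]
  calc ‖F z‖ₑ * μ (Metric.ball z r) = ∫⁻ v in Metric.ball 0 r, ‖F z‖ₑ ∂μ := by
        rw [setLIntegral_const, Measure.addHaar_ball_center]
    _ ≤ ∫⁻ v in Metric.ball 0 r, ENNReal.ofReal (2 * Real.pi)⁻¹ *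
          (∫⁻ θ in Set.Ioc 0 (2 * Real.pi), ‖G (z + circleMap 0 1 θ • v)‖ₑ) ∂μ :=
        setLIntegral_mono' measurableSet_ball hmean
    _ = ENNReal.ofReal (2 * Real.pi)⁻¹ * ∫⁻ v in Metric.ball 0 r,
          (∫⁻ θ in Set.Ioc 0 (2 * Real.pi), ‖G (z + circleMap 0 1 θ • v)‖ₑ) ∂μ := by
        rw [lintegral_const_mul' _ _ ENNReal.ofReal_ne_top]
    _ = ENNReal.ofReal (2 * Real.pi)⁻¹ * ∫⁻ θ in Set.Ioc 0 (2 * Real.pi),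
          ∫⁻ v in Metric.ball 0 r, ‖G (z + circleMap 0 1 θ • v)‖ₑ ∂μ := by
        rw [lintegral_lintegral_swap]
        refine (hGm.comp ?_).enorm.aemeasurable
        have : Measurable (circleMap 0 1) := (continuous_circleMap 0 1).measurable
        fun_prop
    _ = ENNReal.ofReal (2 * Real.pi)⁻¹ * ∫⁻ θ in Set.Ioc 0 (2 * Real.pi),
          ∫⁻ v in Metric.ball z r, ‖G v‖ₑ ∂μ := by
        congr 1
        refine lintegral_congr fun θ => ?_
        have hc0 : circleMap 0 1 θ ≠ 0 := by simp [circleMap]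
        rw [htrans, ← (measurePreserving_smul_of_norm_eq_one μ (hcirc θ)).setLIntegral_comp_preimage
          measurableSet_ball (f := fun v => ‖G (z + v)‖ₑ) (by fun_prop)]
        congr 2
        ext v
        simp [norm_smul]
    _ = ∫⁻ v in Metric.ball z r, ‖F v‖ₑ ∂μ := by
        rw [setLIntegral_const, Real.volume_Ioc, sub_zero, mul_comm, mul_assoc,
          ← ENNReal.ofReal_mul (by positivity), mul_inv_cancel₀ (by positivity), ENNReal.ofReal_one,
          mul_one]
        exact setLIntegral_congr_fun measurableSet_ball fun v hv => by rw [hGF v hv]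

/-- The sub-mean-value property of `‖F‖ ^ σ` for holomorphic `F` and `0 < σ ≤ 1`, up to a constant
which depends only on the radius. -/
theorem exists_enorm_rpow_le_mul_lintegral {σ δ : ℝ} (hσ : 0 < σ) (hσ1 : σ ≤ 1) (hδ : 0 < δ) :
    ∃ C : ℝ≥0∞, C ≠ ∞ ∧ ∀ (F : V → ℂ) (z : V), DifferentiableOn ℂ F (Metric.closedBall z δ) →
      ‖F z‖ₑ ^ σ ≤ C * ∫⁻ v in Metric.ball z δ, ‖F v‖ₑ ^ σ ∂μ := by
  have : FiniteDimensional ℝ V := FiniteDimensional.complexToReal V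
  have : ProperSpace V := FiniteDimensional.proper ℝ V
  set d := Module.finrank ℝ V
  set m := μ.real (Metric.ball 0 1) with hm
  have hm0 : 0 < m := ENNReal.toReal_pos (Metric.measure_ball_pos μ 0 one_pos).ne'
    measure_ball_lt_top.ne
  -- The exponent has to match the volume growth `ρ ^ d`. Taking `d + 1` instead of `d` keeps `N`
  -- positive in dimension zero; the surplus factor `2ρ ≤ δ` is cancelled in `hfin`.
  set N : ℝ := (d + 1) / σ with hN
  have hN0 : 0 < N := by positivity
  have hNσ : N * σ = d + 1 := by rw [hN]; field_simp
  set C : ℝ := 2 ^ d * ((2 : ℝ) ^ N) ^ (1 - σ) / (δ ^ d * m) with hC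
  have hC0 : 0 < C := by positivity
  refine ⟨ENNReal.ofReal C, ENNReal.ofReal_ne_top, fun F z hF => ?_⟩
  set I := ∫⁻ v in Metric.ball z δ, ‖F v‖ₑ ^ σ ∂μ with hI
  rcases eq_or_ne I ∞ with hItop | hItop
  · rw [hItop, ENNReal.mul_top (by simpa using hC0)]
    exact le_top
  rcases eq_or_ne (F z) 0 with hFz | hFz
  · simp [hFz, hσ]
  -- Maximising `‖F v‖ (δ - ‖v - z‖)^N` yields a point `w` around which `‖F‖ ≤ 2^N ‖F w‖` on a ball
  -- of radius half of `δ - ‖w - z‖`. There `‖F‖ ≤ (2^N ‖F w‖)^(1-σ) ‖F‖^σ`, which turns the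
  -- mean-value inequality for `‖F‖` into one for `‖F‖^σ`.
  obtain ⟨w, hw, hmax⟩ := (isCompact_closedBall z δ).exists_isMaxOn
    ⟨z, Metric.mem_closedBall_self hδ.le⟩
    (f := fun v => ‖F v‖ * (δ - ‖v - z‖) ^ N) (by
      refine (hF.continuousOn.norm).mul (ContinuousOn.rpow_const (by fun_prop) fun _ _ => .inr hN0.le))
  have hzw := hmax (Metric.mem_closedBall_self hδ.le)
  simp only [Set.mem_ofPred_eq, sub_self, norm_zero, sub_zero] at hzw
  rw [Metric.mem_closedBall, dist_eq_norm] at hw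
  have hR : 0 < δ - ‖w - z‖ := by
    rcases (sub_nonneg.2 hw).eq_or_lt with h | h
    · rw [← h, Real.zero_rpow hN0.ne', mul_zero] at hzw
      have : 0 < ‖F z‖ * δ ^ N := by positivity
      linarith
    · exact h
  obtain ⟨ρ, hρ⟩ : ∃ ρ, ρ = (δ - ‖w - z‖) / 2 := ⟨_, rfl⟩
  have hρ0 : 0 < ρ := by rw [hρ]; positivity
  have hρ2 : δ - ‖w - z‖ = 2 * ρ := by rw [hρ]; ring
  have hρδ : 2 * ρ ≤ δ := by rw [← hρ2]; linarith [norm_nonneg (w - z)]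
  have hdist : ∀ v ∈ Metric.ball w ρ, ρ < δ - ‖v - z‖ := fun v hv => by
    rw [Metric.mem_ball, dist_eq_norm] at hv
    have := norm_sub_le_norm_sub_add_norm_sub v w z
    linarith
  have hsub : Metric.ball w ρ ⊆ Metric.ball z δ := fun v hv => by
    rw [Metric.mem_ball, dist_eq_norm]
    linarith [hdist v hv]
  have hFw : 0 < ‖F w‖ := by
    refine norm_pos_iff.2 fun h => ?_
    rw [h, norm_zero, zero_mul] at hzw
    have : 0 < ‖F z‖ * δ ^ N := by positivity
    linarith
  have hbd : ∀ v ∈ Metric.ball w ρ, ‖F v‖ ≤ 2 ^ N * ‖F w‖ := by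
    intro v hv
    have h1 := hmax (Metric.ball_subset_closedBall (hsub hv))
    simp only [Set.mem_ofPred_eq] at h1
    rw [hρ2, Real.mul_rpow two_pos.le hρ0.le] at h1
    have h2 : ‖F v‖ * ρ ^ N ≤ ‖F v‖ * (δ - ‖v - z‖) ^ N := by
      gcongr
      exact (hdist v hv).le
    have h3 : 0 < ρ ^ N := by positivity
    refine le_of_mul_le_mul_right ?_ h3
    linarith
  have hmean := enorm_mul_measure_ball_le_lintegral μ (z := w) (r := ρ)
    (hF.mono (hsub.trans Metric.ball_subset_closedBall))
  have hint : ∫⁻ v in Metric.ball w ρ, ‖F v‖ₑ ∂μ ≤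
      ENNReal.ofReal ((2 ^ N * ‖F w‖) ^ (1 - σ)) * I := by
    calc ∫⁻ v in Metric.ball w ρ, ‖F v‖ₑ ∂μ
        ≤ ∫⁻ v in Metric.ball w ρ, ENNReal.ofReal ((2 ^ N * ‖F w‖) ^ (1 - σ)) * ‖F v‖ₑ ^ σ ∂μ := by
          refine setLIntegral_mono' measurableSet_ball fun v hv => ?_
          rcases eq_or_ne (F v) 0 with h0 | h0
          · simp [h0]
          have hFv : 0 < ‖F v‖ := norm_pos_iff.2 h0
          rw [← ofReal_norm, ENNReal.ofReal_rpow_of_pos hFv, ← ENNReal.ofReal_mul (by positivity)]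
          refine ENNReal.ofReal_le_ofReal ?_
          calc ‖F v‖ = ‖F v‖ ^ (1 - σ) * ‖F v‖ ^ σ := by
                rw [← Real.rpow_add hFv]; simp
            _ ≤ _ := by
                gcongr
                exact hbd v hv
      _ = ENNReal.ofReal ((2 ^ N * ‖F w‖) ^ (1 - σ)) * ∫⁻ v in Metric.ball w ρ, ‖F v‖ₑ ^ σ ∂μ :=
          lintegral_const_mul' _ _ ENNReal.ofReal_ne_top
      _ ≤ _ := by
          gcongr
          exact lintegral_mono_set hsub
  have hreal : ‖F w‖ * (ρ ^ d * m) ≤ (2 ^ N * ‖F w‖) ^ (1 - σ) * I.toReal := by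
    have h := hmean.trans hint
    rw [Measure.addHaar_ball_of_pos μ w hρ0] at h
    have h2 := ENNReal.toReal_mono (ENNReal.mul_ne_top ENNReal.ofReal_ne_top hItop) h
    rwa [ENNReal.toReal_mul, ENNReal.toReal_mul, ENNReal.toReal_mul, toReal_enorm,
      ENNReal.toReal_ofReal (by positivity), ENNReal.toReal_ofReal (by positivity)] at h2
  have hreal2 : ‖F w‖ ^ σ * (ρ ^ d * m) ≤ ((2 : ℝ) ^ N) ^ (1 - σ) * I.toReal := by
    rw [Real.mul_rpow (by positivity) hFw.le] at hreal
    have h1 : ‖F w‖ = ‖F w‖ ^ (1 - σ) * ‖F w‖ ^ σ := by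
      rw [← Real.rpow_add hFw]; simp
    have h2 : 0 < ‖F w‖ ^ (1 - σ) := by positivity
    refine le_of_mul_le_mul_left ?_ h2
    calc _ = ‖F w‖ * (ρ ^ d * m) := by rw [← mul_assoc, ← h1]
      _ ≤ _ := hreal
      _ = _ := by ring
  have hz2 : ‖F z‖ ^ σ * δ ^ (d + 1) ≤ ‖F w‖ ^ σ * (2 * ρ) ^ (d + 1) := by
    have h := Real.rpow_le_rpow (by positivity) hzw hσ.le
    rw [hρ2, Real.mul_rpow (by positivity) (by positivity), Real.mul_rpow (by positivity)
      (by positivity), ← Real.rpow_mul hδ.le, ← Real.rpow_mul (by positivity), hNσ] at h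
    exact_mod_cast h
  have hfin : ‖F z‖ ^ σ ≤ C * I.toReal := by
    have hI0 : 0 ≤ I.toReal := ENNReal.toReal_nonneg
    rw [hC, div_mul_eq_mul_div, le_div_iff₀ (by positivity)]
    refine le_of_mul_le_mul_right ?_ hδ
    calc ‖F z‖ ^ σ * (δ ^ d * m) * δ = ‖F z‖ ^ σ * δ ^ (d + 1) * m := by ring
      _ ≤ ‖F w‖ ^ σ * (2 * ρ) ^ (d + 1) * m := by gcongr
      _ = 2 ^ d * (2 * ρ) * (‖F w‖ ^ σ * (ρ ^ d * m)) := by ring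
      _ ≤ 2 ^ d * δ * (((2 : ℝ) ^ N) ^ (1 - σ) * I.toReal) := by gcongr
      _ = _ := by ring
  rw [← ofReal_norm, ENNReal.ofReal_rpow_of_pos (norm_pos_iff.2 hFz)]
  refine (ENNReal.ofReal_le_ofReal hfin).trans (le_of_eq ?_)
  rw [ENNReal.ofReal_mul hC0.le, ENNReal.ofReal_toReal hItop]

end MeanValue

/-! ### Plancherel and the Hausdorff–Young inequality -/

section HausdorffYoung

variable {E : Type*} [NormedAddCommGroup E] [InnerProductSpace ℝ E] [FiniteDimensional ℝ E]
  [MeasurableSpace E] [BorelSpace E]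

open SchwartzMap ContDiff in
/-- Plancherel's theorem for the Fourier integral of a function in `L¹ ∩ L²`. -/
theorem fourier_memLp_two_and_eLpNorm_eq {u : E → ℂ} (h1 : Integrable u) (h2 : MemLp u 2) :
    MemLp (𝓕 u : E → ℂ) 2 volume ∧ eLpNorm (𝓕 u : E → ℂ) 2 volume = eLpNorm u 2 volume := by
  have hcont : Continuous (𝓕 u) :=
    VectorFourier.fourierIntegral_continuous Real.continuous_fourierChar continuous_inner h1
  set U : Lp ℂ 2 (volume : Measure E) := 𝓕 (h2.toLp u) with hU
  -- The `L²` transform and the Fourier integral agree because, tested against a smooth compactly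
  -- supported function, both move the transform onto the test function.
  have key : ∀ᵐ x, 𝓕 u x = U x := by
    refine ae_eq_of_integral_contDiff_smul_eq hcont.locallyIntegrable
      ((Lp.memLp U).locallyIntegrable (by norm_num)) fun g hg hgc => ?_
    have hg1 : HasCompactSupport (fun x => (g x : ℂ)) := hgc.comp_left Complex.ofReal_zero
    have hg2 : ContDiff ℝ ∞ (fun x => (g x : ℂ)) := Complex.ofRealCLM.contDiff.comp hg
    set φ : 𝓢(E, ℂ) := hg1.toSchwartzMap hg2 with hφ
    have hφg : ∀ x, φ x = (g x : ℂ) := fun x => rfl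
    have e1 : ∫ x, g x • U x = ∫ x, (𝓕 φ) x • u x := by
      have h := congrArg (fun T => T φ) (Lp.fourier_toTemperedDistribution_eq (h2.toLp u))
      simp only [TemperedDistribution.fourier_apply, Lp.toTemperedDistribution_apply] at h
      calc ∫ x, g x • U x = ∫ x, φ x • U x := by
            refine integral_congr_ae (.of_forall fun x => ?_)
            simp [hφg]
        _ = _ := h.symm
        _ = _ := by
            refine integral_congr_ae ?_
            filter_upwards [h2.coeFn_toLp] with x hx
            rw [hx]
    have e2 : ∫ x, g x • 𝓕 u x = ∫ x, (𝓕 φ) x • u x := by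
      have h := VectorFourier.integral_fourierIntegral_smul_eq_flip (μ := volume) (ν := volume)
        (L := innerₗ E) (f := u) (g := φ) Real.continuous_fourierChar continuous_inner h1
        φ.integrable
      rw [flip_innerₗ] at h
      calc ∫ x, g x • 𝓕 u x = ∫ x, 𝓕 u x • φ x := by
            refine integral_congr_ae (.of_forall fun x => ?_)
            simp [hφg, mul_comm]
        _ = ∫ x, u x • 𝓕 (φ : E → ℂ) x := h
        _ = _ := by
            refine integral_congr_ae (.of_forall fun x => ?_)
            simp [mul_comm, SchwartzMap.fourier_coe]
    rw [e1, e2]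
  have hmem : MemLp (𝓕 u : E → ℂ) 2 volume := (memLp_congr_ae key).2 (Lp.memLp U)
  refine ⟨hmem, ?_⟩
  rw [eLpNorm_congr_ae key, ← Lp.enorm_def, hU, ← ofReal_norm, Lp.norm_fourier_eq, ofReal_norm,
    Lp.enorm_def, eLpNorm_congr_ae h2.coeFn_toLp]

/-- The power `|a| ^ ζ * (a / |a|)`. -/
noncomputable def signedPow (a ζ : ℂ) : ℂ := a * (‖a‖ : ℂ) ^ (ζ - 1)

theorem signedPow_one (a : ℂ) : signedPow a 1 = a := by simp [signedPow]

theorem norm_signedPow (a : ℂ) {ζ : ℂ} (hζ : 0 < ζ.re) : ‖signedPow a ζ‖ = ‖a‖ ^ ζ.re := by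
  rcases eq_or_ne a 0 with rfl | ha
  · simp [signedPow, hζ.ne']
  have ha' : 0 < ‖a‖ := norm_pos_iff.2 ha
  rw [signedPow, norm_mul, Complex.norm_cpow_eq_rpow_re_of_pos ha', Complex.sub_re, Complex.one_re,
    Real.rpow_sub_one ha'.ne']
  field_simp

theorem differentiable_signedPow (a : ℂ) : Differentiable ℂ (signedPow a) := by
  rcases eq_or_ne a 0 with rfl | ha
  · have : signedPow 0 = fun _ => 0 := by ext; simp [signedPow]
    rw [this]
    exact differentiable_const 0
  have ha' : (‖a‖ : ℂ) ≠ 0 := by simpa using ha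
  intro ζ
  unfold signedPow
  exact ((differentiableAt_id.sub_const 1).const_cpow (.inl ha')).const_mul a

theorem measurable_signedPow (ζ : ℂ) : Measurable fun a => signedPow a ζ := by
  unfold signedPow
  fun_prop

theorem rpow_le_rpow_add_rpow {a x y z : ℝ} (ha : 0 ≤ a) (hx : 0 < x) (hxy : x ≤ y) (hyz : y ≤ z) :
    a ^ y ≤ a ^ x + a ^ z := by
  have h1 : 0 ≤ a ^ x := by positivity
  have h2 : 0 ≤ a ^ z := by positivity
  rcases le_total a 1 with h | h
  · rcases ha.eq_or_lt with rfl | ha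
    · rw [Real.zero_rpow (by linarith)]; positivity
    · linarith [Real.rpow_le_rpow_of_exponent_ge ha h hxy]
  · linarith [Real.rpow_le_rpow_of_exponent_le h hyz]

theorem integrable_signedPow {g : E → ℂ} (hg : Measurable g) {x y : ℝ} (hx : 0 < x)
    (h1 : Integrable fun v => ‖g v‖ ^ x) (h2 : Integrable fun v => ‖g v‖ ^ y) {ζ : ℂ}
    (hxζ : x ≤ ζ.re) (hζy : ζ.re ≤ y) : Integrable fun v => signedPow (g v) ζ := by
  refine (h1.add h2).mono' ((measurable_signedPow ζ).comp hg).aestronglyMeasurable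
    (.of_forall fun v => ?_)
  rw [norm_signedPow _ (hx.trans_le hxζ)]
  exact rpow_le_rpow_add_rpow (norm_nonneg _) hx hxζ hζy

/-- The dual form of Hausdorff–Young, by the three lines theorem. Replace `g` and `h` by their
signed powers with exponent `ζ(z) = p(1 - z/2)`. On `Re z = 0` the moduli are `|g|^p` and `|h|^p`,
and the trivial bound gives `GH`; on `Re z = 1` they are `|g|^{p/2}` and `|h|^{p/2}`, and Plancherel
with Cauchy–Schwarz gives `(GH)^{1/2}`. Integrability of the powers `p/2` and `p` dominates
everything in between. -/
theorem norm_integral_fourier_mul_le {p : ℝ} (hp1 : 1 ≤ p) (hp2 : p ≤ 2) {g h : E → ℂ}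
    (hg : Measurable g) (hh : Measurable h)
    (hg1 : Integrable fun v => ‖g v‖ ^ (p / 2)) (hg2 : Integrable fun v => ‖g v‖ ^ p)
    (hh1 : Integrable fun v => ‖h v‖ ^ (p / 2)) (hh2 : Integrable fun v => ‖h v‖ ^ p) :
    ‖∫ t, 𝓕 g t * h t‖ ≤ ((∫ v, ‖g v‖ ^ p) * ∫ v, ‖h v‖ ^ p) ^ (1 / p) := by
  set G := ∫ v, ‖g v‖ ^ p
  set H := ∫ v, ‖h v‖ ^ p
  have hG : 0 ≤ G := integral_nonneg fun v => by positivity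
  have hH : 0 ≤ H := integral_nonneg fun v => by positivity
  have hp0 : 0 < p / 2 := by positivity
  set ζ : ℂ → ℂ := fun z => p * (1 - z / 2) with hζ
  have hζre : ∀ z, (ζ z).re = p * (1 - z.re / 2) := fun z => by
    simp [hζ]
  have hζl : ∀ z ∈ Complex.HadamardThreeLines.verticalClosedStrip 0 1, p / 2 ≤ (ζ z).re := by
    intro z hz
    rw [hζre]
    nlinarith [hz.1, hz.2]
  have hζr : ∀ z ∈ Complex.HadamardThreeLines.verticalClosedStrip 0 1, (ζ z).re ≤ p := by
    intro z hz
    rw [hζre]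
    nlinarith [hz.1, hz.2]
  set φ : ℂ → E × E → ℂ := fun z w =>
    signedPow (g w.1) (ζ z) * signedPow (h w.2) (ζ z) * (Real.fourierChar (-inner ℝ w.1 w.2) : ℂ)
    with hφ
  set b : E × E → ℝ := fun w => (‖g w.1‖ ^ (p / 2) + ‖g w.1‖ ^ p) *
    (‖h w.2‖ ^ (p / 2) + ‖h w.2‖ ^ p) with hb
  have hbint : Integrable b := (hg1.add hg2).mul_prod (hh1.add hh2)
  have hφm : ∀ z, AEStronglyMeasurable (φ z) := fun z => by
    refine Measurable.aestronglyMeasurable ?_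
    have h1 : Measurable fun w : E × E => signedPow (g w.1) (ζ z) :=
      (measurable_signedPow (ζ z)).comp (hg.comp measurable_fst)
    have h2 : Measurable fun w : E × E => signedPow (h w.2) (ζ z) :=
      (measurable_signedPow (ζ z)).comp (hh.comp measurable_snd)
    have h3 : Continuous fun w : E × E => (Real.fourierChar (-inner ℝ w.1 w.2) : ℂ) :=
      continuous_subtype_val.comp (Real.continuous_fourierChar.comp (by fun_prop))
    exact (h1.mul h2).mul h3.measurable
  have hφd : ∀ w, Differentiable ℂ fun z => φ z w := fun w => by
    have hζd : Differentiable ℂ ζ := by fun_prop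
    exact (((differentiable_signedPow _).comp hζd).mul
      ((differentiable_signedPow _).comp hζd)).mul_const _
  have hφn : ∀ z ∈ Complex.HadamardThreeLines.verticalClosedStrip 0 1, ∀ w,
      ‖φ z w‖ = ‖g w.1‖ ^ (ζ z).re * ‖h w.2‖ ^ (ζ z).re := fun z hz w => by
    have := hp0.trans_le (hζl z hz)
    simp only [hφ, norm_mul, norm_signedPow _ this, Circle.norm_coe, mul_one]
  have hφb : ∀ z ∈ Complex.HadamardThreeLines.verticalClosedStrip 0 1, ∀ w, ‖φ z w‖ ≤ b w := by
    intro z hz w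
    rw [hφn z hz]
    exact mul_le_mul (rpow_le_rpow_add_rpow (norm_nonneg _) hp0 (hζl z hz) (hζr z hz))
      (rpow_le_rpow_add_rpow (norm_nonneg _) hp0 (hζl z hz) (hζr z hz)) (by positivity)
      (by positivity)
  have hφi : ∀ z ∈ Complex.HadamardThreeLines.verticalClosedStrip 0 1, Integrable (φ z) :=
    fun z hz => hbint.mono' (hφm z) (.of_forall (hφb z hz))
  set Φ : ℂ → ℂ := fun z => ∫ w, φ z w with hΦ
  have hΦF : ∀ z ∈ Complex.HadamardThreeLines.verticalClosedStrip 0 1,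
      Φ z = ∫ t, 𝓕 (fun x => signedPow (g x) (ζ z)) t * signedPow (h t) (ζ z) := by
    intro z hz
    rw [hΦ]
    simp only
    rw [Measure.volume_eq_prod, integral_prod_symm _ (hφi z hz)]
    refine integral_congr_ae (.of_forall fun t => ?_)
    simp only [hφ]
    rw [Real.fourier_eq, ← integral_mul_const]
    refine integral_congr_ae (.of_forall fun x => ?_)
    simp only [Circle.smul_def, smul_eq_mul]
    ring
  have hopen : IsOpen (Complex.HadamardThreeLines.verticalStrip 0 1) :=
    isOpen_Ioo.preimage Complex.continuous_re
  have hsub : Complex.HadamardThreeLines.verticalStrip 0 1 ⊆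
      Complex.HadamardThreeLines.verticalClosedStrip 0 1 := Set.preimage_mono Set.Ioo_subset_Icc_self
  have hclosed : IsClosed (Complex.HadamardThreeLines.verticalClosedStrip 0 1) :=
    isClosed_Icc.preimage Complex.continuous_re
  have hdiff : DiffContOnCl ℂ Φ (Complex.HadamardThreeLines.verticalStrip 0 1) := by
    refine ⟨differentiableOn_integral_of_dominated hopen (fun z _ => hφm z)
      (fun w => (hφd w).differentiableOn) (fun z hz => hφb z (hsub hz)) hbint, ?_⟩
    refine ContinuousOn.mono ?_ (closure_minimal hsub hclosed)
    exact continuousOn_of_dominated (fun z _ => hφm z) (fun z hz => .of_forall (hφb z hz)) hbint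
      (.of_forall fun w => (hφd w).continuous.continuousOn)
  have hbdd : BddAbove ((norm ∘ Φ) '' Complex.HadamardThreeLines.verticalClosedStrip 0 1) := by
    refine ⟨∫ w, b w, ?_⟩
    rintro _ ⟨z, hz, rfl⟩
    exact norm_integral_le_of_norm_le hbint (.of_forall (hφb z hz))
  have h0 : ∀ z ∈ Complex.re ⁻¹' {0}, ‖Φ z‖ ≤ G * H := by
    intro z hz
    have hz0 : z.re = 0 := hz
    have hzs : z ∈ Complex.HadamardThreeLines.verticalClosedStrip 0 1 := by
      constructor <;> simp [hz0]
    refine (norm_integral_le_integral_norm _).trans (le_of_eq ?_)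
    simp only [hφn z hzs, hζre, hz0, zero_div, sub_zero, mul_one]
    exact integral_prod_mul (fun x => ‖g x‖ ^ p) (fun x => ‖h x‖ ^ p)
  have h1 : ∀ z ∈ Complex.re ⁻¹' {1}, ‖Φ z‖ ≤ (G * H) ^ (1 / 2 : ℝ) := by
    intro z hz
    have hz1 : z.re = 1 := hz
    have hzs : z ∈ Complex.HadamardThreeLines.verticalClosedStrip 0 1 := by
      constructor <;> simp [hz1]
    have hzre : (ζ z).re = p / 2 := by rw [hζre, hz1]; ring
    have hsq : ∀ {k : E → ℂ}, Measurable k → Integrable (fun v => ‖k v‖ ^ p) →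
        MemLp (fun x => signedPow (k x) (ζ z)) 2 ∧
          ∀ x, ‖signedPow (k x) (ζ z)‖ ^ (2 : ℝ) = ‖k x‖ ^ p := by
      intro k hk hki
      have hn : ∀ x, ‖signedPow (k x) (ζ z)‖ ^ (2 : ℝ) = ‖k x‖ ^ p := fun x => by
        rw [norm_signedPow _ (by rw [hzre]; exact hp0), hzre, ← Real.rpow_mul (norm_nonneg _)]
        congr 1
        ring
      refine ⟨(memLp_two_iff_integrable_sq_norm
        ((measurable_signedPow _).comp hk).aestronglyMeasurable).2 ?_, hn⟩
      refine hki.congr (.of_forall fun x => ?_)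
      simp only
      rw [← hn, Real.rpow_two]
      rfl
    obtain ⟨hu, hun⟩ := hsq hg hg2
    obtain ⟨hv, hvn⟩ := hsq hh hh2
    have hui := integrable_signedPow hg hp0 hg1 hg2 (hζl z hzs) (hζr z hzs)
    obtain ⟨hFu, hFun⟩ := fourier_memLp_two_and_eLpNorm_eq hui hu
    have hnorm : ∫ t, ‖𝓕 (fun x => signedPow (g x) (ζ z)) t‖ ^ (2 : ℝ) = G := by
      have e : ∀ {k : E → ℂ}, MemLp k 2 →
          ∫ t, ‖k t‖ ^ (2 : ℝ) = (eLpNorm k 2 volume).toReal ^ (2 : ℝ) := by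
        intro k hk
        rw [hk.eLpNorm_eq_integral_rpow_norm two_ne_zero ENNReal.ofNat_ne_top,
          ENNReal.toReal_ofReal (by positivity), ← Real.rpow_mul
            (integral_nonneg fun _ => by positivity)]
        simp
      rw [e hFu, hFun, ← e hu]
      simp only [hun]
      rfl
    rw [hΦF z hzs]
    have hCS := integral_mul_norm_le_Lp_mul_Lq (μ := volume) Real.HolderConjugate.two_two
      (f := 𝓕 (fun x => signedPow (g x) (ζ z))) (g := fun x => signedPow (h x) (ζ z))
      (by simpa using hFu) (by simpa using hv)
    rw [hnorm] at hCS
    simp only [hvn] at hCS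
    rw [Real.mul_rpow hG hH]
    refine (norm_integral_le_integral_norm _).trans ?_
    simpa only [norm_mul] using hCS
  -- The solution of `ζ(θ) = 1`, where the original pairing reappears; the interpolated exponent is
  -- `(1 - θ) + θ/2 = 1/p`.
  set θ : ℝ := 2 - 2 / p with hθ
  have hθ0 : 0 ≤ θ := by rw [hθ, sub_nonneg, div_le_iff₀ (by linarith)]; linarith
  have hθ1 : θ ≤ 1 := by
    rw [hθ, sub_le_comm, le_div_iff₀ (by linarith)]; linarith
  have hθs : (θ : ℂ) ∈ Complex.HadamardThreeLines.verticalClosedStrip 0 1 := by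
    constructor <;> simpa
  have hζθ : ζ θ = 1 := by
    have : (p : ℂ) ≠ 0 := by exact_mod_cast (by linarith : p ≠ 0)
    simp only [hζ, hθ]
    push_cast
    field_simp
    ring
  have hmain := Complex.HadamardThreeLines.norm_le_interp_of_mem_verticalClosedStrip₀₁' Φ hθs hdiff
    hbdd h0 h1
  rw [hΦF _ hθs, hζθ, Complex.ofReal_re, ← Real.rpow_mul (by positivity),
    ← Real.rpow_add_of_nonneg (by positivity) (by linarith) (by positivity)] at hmain
  simp only [signedPow_one] at hmain
  refine hmain.trans (le_of_eq ?_)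
  congr 1
  rw [hθ]
  field_simp
  ring

/-- The **Hausdorff–Young inequality**. -/
theorem lintegral_fourier_rpow_le {p q : ℝ} (hpq : p.HolderConjugate q) (hp2 : p ≤ 2) {g : E → ℂ}
    (hg : Measurable g) (hg1 : Integrable fun v => ‖g v‖ ^ (p / 2))
    (hg2 : Integrable fun v => ‖g v‖ ^ p) :
    (∫⁻ t, ‖𝓕 g t‖ₑ ^ q) ^ (1 / q) ≤ (∫⁻ x, ‖g x‖ₑ ^ p) ^ (1 / p) := by
  have hp1 : 1 < p := hpq.lt
  have hq1 : 1 < q := hpq.symm.lt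
  have hgi : Integrable g := by
    refine (hg1.add hg2).mono' hg.aestronglyMeasurable (.of_forall fun v => ?_)
    have := rpow_le_rpow_add_rpow (norm_nonneg (g v)) (x := p / 2) (y := 1) (z := p) (by positivity)
      (by linarith) hp1.le
    simpa using this
  have hcont : Continuous (𝓕 g) :=
    VectorFourier.fourierIntegral_continuous Real.continuous_fourierChar continuous_inner hgi
  set G := ∫ v, ‖g v‖ ^ p with hG
  have hG0 : 0 ≤ G := integral_nonneg fun v => by positivity
  have hlint : ∀ {k : E → ℂ} {r : ℝ} {ν : Measure E}, 0 ≤ r → Integrable (fun v => ‖k v‖ ^ r) ν →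
      ∫⁻ v, ‖k v‖ₑ ^ r ∂ν = ENNReal.ofReal (∫ v, ‖k v‖ ^ r ∂ν) := fun hr hk => by
    rw [ofReal_integral_eq_lintegral_ofReal hk (.of_forall fun v => by positivity)]
    refine lintegral_congr fun v => ?_
    rw [← ofReal_norm, ENNReal.ofReal_rpow_of_nonneg (norm_nonneg _) hr]
  have hball : ∀ R : ℕ, ∫⁻ t in Metric.ball 0 R, ‖𝓕 g t‖ₑ ^ q ≤ ENNReal.ofReal (G ^ (q / p)) := by
    intro R
    have hfin : volume (Metric.ball (0 : E) R) < ∞ := measure_ball_lt_top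
    obtain ⟨M, hM⟩ : ∃ M, ∀ t, ‖𝓕 g t‖ ≤ M :=
      ⟨∫ v, ‖g v‖, fun t => VectorFourier.norm_fourierIntegral_le_integral_norm _ _ _ _ _⟩
    have hM0 : 0 ≤ M := (norm_nonneg _).trans (hM 0)
    -- The extremal function for duality: `𝓕 g · h = |𝓕 g|^q` and `|h|^p = |𝓕 g|^q` on the ball. The
    -- pairing bound becomes `A ≤ (G A)^{1/p}`; the cut-off makes `A` finite, so it can be divided
    -- out.
    set h : E → ℂ := (Metric.ball 0 (R : ℝ)).indicator
      fun t => (starRingEnd ℂ) (𝓕 g t) * (‖𝓕 g t‖ ^ (q - 2) : ℝ) with hh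
    have hhm : Measurable h := by
      refine Measurable.indicator ?_ measurableSet_ball
      have := hcont.measurable
      refine (Complex.continuous_conj.measurable.comp this).mul ?_
      exact Complex.measurable_ofReal.comp (this.norm.pow_const _)
    have hhn : ∀ {r : ℝ}, 0 < r → ∀ t, ‖h t‖ ^ r =
        (Metric.ball 0 (R : ℝ)).indicator (fun t => ‖𝓕 g t‖ ^ ((q - 1) * r)) t := by
      intro r hr t
      by_cases ht : t ∈ Metric.ball 0 (R : ℝ)
      · rw [hh, Set.indicator_of_mem ht, Set.indicator_of_mem ht]
        rcases eq_or_ne (𝓕 g t) 0 with h0 | h0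
        · rw [h0]
          have : (q - 1) * r ≠ 0 := by
            have : 0 < q - 1 := by linarith
            positivity
          simp [Real.zero_rpow this, Real.zero_rpow hr.ne']
        · have h0' := norm_pos_iff.2 h0
          rw [norm_mul, RCLike.norm_conj, Complex.norm_real, Real.norm_of_nonneg (by positivity),
            Real.rpow_mul (norm_nonneg _)]
          congr 1
          rw [show q - 1 = 1 + (q - 2) by ring, Real.rpow_add h0', Real.rpow_one]
      · rw [hh, Set.indicator_of_notMem ht, Set.indicator_of_notMem ht]
        simp [Real.zero_rpow hr.ne']
    have hpow : ∀ {r : ℝ}, 0 ≤ r →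
        IntegrableOn (fun t => ‖𝓕 g t‖ ^ r) (Metric.ball 0 (R : ℝ)) := fun {r} hr => by
      refine Measure.integrableOn_of_bounded (M := M ^ r) hfin.ne
        (hcont.measurable.norm.pow_const r).aestronglyMeasurable (.of_forall fun t => ?_)
      rw [Real.norm_of_nonneg (by positivity)]
      gcongr
      exact hM t
    have hhi : ∀ {r : ℝ}, 0 < r → Integrable fun t => ‖h t‖ ^ r := fun {r} hr => by
      have : 0 ≤ (q - 1) * r := mul_nonneg (by linarith) hr.le
      refine ((hpow this).integrable_indicator measurableSet_ball).congr
        (.of_forall fun t => (hhn hr t).symm)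
    have hmain := norm_integral_fourier_mul_le hp1.le hp2 hg hhm hg1 hg2 (hhi (by positivity))
      (hhi (by positivity))
    set A := ∫ t in Metric.ball 0 (R : ℝ), ‖𝓕 g t‖ ^ q with hA
    have hA0 : 0 ≤ A := integral_nonneg fun v => by positivity
    have e1 : ∫ t, 𝓕 g t * h t = (A : ℂ) := by
      rw [hA, ← integral_complex_ofReal, ← integral_indicator measurableSet_ball]
      refine integral_congr_ae (.of_forall fun t => ?_)
      by_cases ht : t ∈ Metric.ball 0 (R : ℝ)
      · simp only [hh, Set.indicator_of_mem ht]
        rcases eq_or_ne (𝓕 g t) 0 with h0 | h0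
        · simp [h0, Real.zero_rpow (by linarith : q ≠ 0)]
        · have h0' := norm_pos_iff.2 h0
          rw [← mul_assoc, Complex.mul_conj, Complex.normSq_eq_norm_sq, ← Complex.ofReal_mul]
          congr 1
          rw [← Real.rpow_two, ← Real.rpow_add h0']
          congr 1
          ring
      · simp only [hh, Set.indicator_of_notMem ht, mul_zero]
    have e2 : ∫ t, ‖h t‖ ^ p = A := by
      rw [hA, ← integral_indicator measurableSet_ball]
      refine integral_congr_ae (.of_forall fun t => ?_)
      simp only [hhn (by positivity : 0 < p) t]
      congr 2
      ext t
      congr 1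
      rw [mul_comm]
      linarith [hpq.mul_eq_add]
    rw [e1, e2, Complex.norm_real, Real.norm_of_nonneg hA0, Real.mul_rpow hG0 hA0] at hmain
    rw [hlint (by linarith) (hpow (by linarith))]
    refine ENNReal.ofReal_le_ofReal ?_
    rcases hA0.eq_or_lt with h0 | h0
    · rw [← hA, ← h0]; positivity
    have h1 : A ^ (1 / q) ≤ G ^ (1 / p) := by
      have h2 : 0 < A ^ (1 / p) := by positivity
      refine le_of_mul_le_mul_right ?_ h2
      rw [← Real.rpow_add h0]
      have : 1 / q + 1 / p = 1 := by
        have := hpq.inv_add_inv_eq_one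
        simp only [one_div]; linarith
      rwa [this, Real.rpow_one]
    have h2 := Real.rpow_le_rpow (by positivity) h1 (by linarith : 0 ≤ q)
    rw [← Real.rpow_mul hA0, ← Real.rpow_mul hG0, one_div_mul_cancel (by linarith),
      Real.rpow_one] at h2
    rwa [show 1 / p * q = q / p by ring] at h2
  have hall : ∫⁻ t, ‖𝓕 g t‖ₑ ^ q ≤ ENNReal.ofReal (G ^ (q / p)) := by
    have hU : (⋃ R : ℕ, Metric.ball (0 : E) R) = Set.univ := Metric.iUnion_ball_nat 0
    rw [← setLIntegral_univ, ← hU, setLIntegral_iUnion_of_directed]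
    · exact iSup_le hball
    · exact directed_of_isDirected_le fun m n hmn => Metric.ball_subset_ball (by exact_mod_cast hmn)
  rw [hlint (by linarith) hg2, ← hG]
  calc (∫⁻ t, ‖𝓕 g t‖ₑ ^ q) ^ (1 / q) ≤ ENNReal.ofReal (G ^ (q / p)) ^ (1 / q) := by gcongr
    _ = _ := by
      rw [ENNReal.ofReal_rpow_of_nonneg (by positivity) (by positivity),
        ENNReal.ofReal_rpow_of_nonneg hG0 (by positivity), ← Real.rpow_mul hG0]
      congr 2
      field_simp

end HausdorffYoung

/-! ### Coordinates on the tube and Gaussian factors -/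

section Tube

variable {n : ℕ}

theorem cpoint_apply (x y : EuclideanSpace ℝ (Fin n)) (j : Fin n) :
    cpoint x y j = (x j : ℂ) + (y j : ℂ) * Complex.I := rfl

/-- Displacement along a complex multiple of a real vector: this reduces moving the slice to one
complex variable `w`. -/
theorem cpoint_add_smul (x y v : EuclideanSpace ℝ (Fin n)) (w : ℂ) :
    cpoint (x + w.re • v) (y + w.im • v) = cpoint x y + w • cpoint v 0 := by
  ext j
  simp only [cpoint_apply, PiLp.add_apply, PiLp.smul_apply, smul_eq_mul, PiLp.zero_apply]
  push_cast
  linear_combination (v j : ℂ) * Complex.re_add_im w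

/-- The identification of `ℝⁿ × ℝⁿ` with `ℂⁿ`. -/
def cpointAddEquiv (n : ℕ) :
    EuclideanSpace ℝ (Fin n) × EuclideanSpace ℝ (Fin n) ≃+ EuclideanSpace ℂ (Fin n) where
  toFun w := cpoint w.1 w.2
  invFun z := (WithLp.toLp 2 fun j => (z j).re, WithLp.toLp 2 fun j => (z j).im)
  left_inv w := by ext j <;> simp [cpoint_apply]
  right_inv z := by ext j; simp [cpoint_apply]
  map_add' w w' := by
    ext j
    simp only [cpoint_apply, PiLp.add_apply, Prod.fst_add, Prod.snd_add]
    push_cast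
    ring

theorem continuous_cpoint :
    Continuous fun w : EuclideanSpace ℝ (Fin n) × EuclideanSpace ℝ (Fin n) => cpoint w.1 w.2 := by
  unfold cpoint
  refine (PiLp.continuous_toLp 2 _).comp (continuous_pi fun j => ?_)
  fun_prop

theorem continuous_cpoint_left (y : EuclideanSpace ℝ (Fin n)) :
    Continuous fun x => cpoint x y :=
  continuous_cpoint.comp (continuous_id.prodMk continuous_const)

theorem norm_cpoint_sq (x y : EuclideanSpace ℝ (Fin n)) :
    ‖cpoint x y‖ ^ 2 = ‖x‖ ^ 2 + ‖y‖ ^ 2 := by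
  simp only [EuclideanSpace.norm_sq_eq, ← Finset.sum_add_distrib, cpoint_apply]
  refine Finset.sum_congr rfl fun j _ => ?_
  rw [← Complex.normSq_eq_norm_sq, Complex.normSq_add_mul_I]
  simp

theorem cpoint_sub (x y x' y' : EuclideanSpace ℝ (Fin n)) :
    cpoint x y - cpoint x' y' = cpoint (x - x') (y - y') :=
  ((cpointAddEquiv n).map_sub (x, y) (x', y')).symm

theorem mem_ball_of_cpoint_mem_ball {x y x' y' : EuclideanSpace ℝ (Fin n)} {δ : ℝ}
    (h : cpoint x y ∈ Metric.ball (cpoint x' y') δ) : x ∈ Metric.ball x' δ ∧ y ∈ Metric.ball y' δ := by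
  rw [Metric.mem_ball, dist_eq_norm, cpoint_sub] at h
  have h2 := norm_cpoint_sq (x - x') (y - y')
  have := norm_nonneg (cpoint (x - x') (y - y'))
  simp only [Metric.mem_ball, dist_eq_norm]
  constructor
  · exact (le_of_sq_le_sq (by nlinarith [sq_nonneg ‖y - y'‖]) this).trans_lt h
  · exact (le_of_sq_le_sq (by nlinarith [sq_nonneg ‖x - x'‖]) this).trans_lt h

/-- Lebesgue measure on `ℂⁿ`. -/
noncomputable def complexVolume (n : ℕ) : Measure (EuclideanSpace ℂ (Fin n)) :=
  ((volume : Measure (EuclideanSpace ℝ (Fin n))).prod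
    (volume : Measure (EuclideanSpace ℝ (Fin n)))).map (cpointAddEquiv n)

theorem continuous_cpointAddEquiv_symm : Continuous (cpointAddEquiv n).symm := by
  change Continuous fun z : EuclideanSpace ℂ (Fin n) =>
    ((WithLp.toLp 2 fun j => (z j).re, WithLp.toLp 2 fun j => (z j).im) :
      EuclideanSpace ℝ (Fin n) × EuclideanSpace ℝ (Fin n))
  refine Continuous.prodMk ?_ ?_ <;>
    refine (PiLp.continuous_toLp 2 _).comp (continuous_pi fun j => ?_) <;> fun_prop

instance : (complexVolume n).IsAddHaarMeasure :=
  (cpointAddEquiv n).isAddHaarMeasure_map _ continuous_cpoint continuous_cpointAddEquiv_symm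

theorem cpoint_mem_tube {B : Set (EuclideanSpace ℝ (Fin n))} {x y : EuclideanSpace ℝ (Fin n)} :
    cpoint x y ∈ tube B ↔ y ∈ B := by
  refine ⟨?_, fun h => ⟨x, y, h, rfl⟩⟩
  rintro ⟨x', y', hy', h⟩
  have : (x, y) = (x', y') := (cpointAddEquiv n).injective h
  rw [Prod.mk.injEq] at this
  rwa [this.2]

theorem isOpen_tube {B : Set (EuclideanSpace ℝ (Fin n))} (hB : IsOpen B) : IsOpen (tube B) := by
  have : tube B = (fun z => ((cpointAddEquiv n).symm z).2) ⁻¹' B := by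
    ext z
    obtain ⟨w, rfl⟩ := (cpointAddEquiv n).surjective z
    rw [Set.mem_preimage, AddEquiv.symm_apply_apply]
    exact cpoint_mem_tube
  rw [this]
  exact hB.preimage (continuous_snd.comp continuous_cpointAddEquiv_symm)

theorem dot_cpoint (t x y : EuclideanSpace ℝ (Fin n)) :
    dot t (cpoint x y) = (inner ℝ t x : ℝ) + (inner ℝ t y : ℝ) * Complex.I := by
  simp only [dot, cpoint_apply, PiLp.inner_apply, RCLike.inner_apply, conj_trivial]
  push_cast
  rw [Finset.sum_mul, ← Finset.sum_add_distrib]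
  exact Finset.sum_congr rfl fun j _ => by ring

theorem differentiable_dot (t : EuclideanSpace ℝ (Fin n)) : Differentiable ℂ (dot t) := by
  unfold dot
  fun_prop

theorem norm_exp_dot (t x y : EuclideanSpace ℝ (Fin n)) (a : ℝ) :
    ‖Complex.exp (a * Complex.I * dot t (cpoint x y))‖ = Real.exp (-a * inner ℝ t y) := by
  rw [Complex.norm_exp, dot_cpoint]
  congr 1
  simp

/-- The holomorphic quadratic form `z₁² + ⋯ + zₙ²`. -/
def sumSq (z : EuclideanSpace ℂ (Fin n)) : ℂ := ∑ j, z j ^ 2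

theorem differentiable_sumSq : Differentiable ℂ (sumSq : EuclideanSpace ℂ (Fin n) → ℂ) := by
  unfold sumSq
  fun_prop

theorem re_sumSq_cpoint (x y : EuclideanSpace ℝ (Fin n)) :
    (sumSq (cpoint x y)).re = ‖x‖ ^ 2 - ‖y‖ ^ 2 := by
  simp only [sumSq, cpoint_apply, EuclideanSpace.norm_sq_eq, Complex.re_sum,
    ← Finset.sum_sub_distrib]
  refine Finset.sum_congr rfl fun j _ => ?_
  simp [pow_two]

theorem norm_exp_sumSq (ε : ℝ) (x y : EuclideanSpace ℝ (Fin n)) :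
    ‖Complex.exp (-ε * sumSq (cpoint x y))‖ = Real.exp (-ε * (‖x‖ ^ 2 - ‖y‖ ^ 2)) := by
  rw [Complex.norm_exp, ← re_sumSq_cpoint]
  congr 1
  rw [← Complex.ofReal_neg, Complex.re_ofReal_mul]

theorem integrable_exp_neg_mul_norm_sq {c : ℝ} (hc : 0 < c) :
    Integrable fun x : EuclideanSpace ℝ (Fin n) => Real.exp (-c * ‖x‖ ^ 2) := by
  have := (GaussianFourier.integrable_cexp_neg_mul_sq_norm_add (b := c) (by simpa) 0
    (0 : EuclideanSpace ℝ (Fin n))).norm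
  refine this.congr (.of_forall fun x => ?_)
  simp only [Complex.norm_exp]
  congr 1
  simp [← Complex.ofReal_pow]

theorem integrable_exp_neg_mul_norm {c : ℝ} (hc : 0 < c) :
    Integrable fun x : EuclideanSpace ℝ (Fin n) => Real.exp (-c * ‖x‖) := by
  have h2 := integrable_one_add_norm (E := EuclideanSpace ℝ (Fin n)) (μ := volume)
    (r := n + 1) (by simp)
  -- The constant comes from `(c(1 + r))^{n+1} / (n+1)! ≤ e^{c(1 + r)}`.
  obtain ⟨C, hC⟩ : ∃ C : ℝ, ∀ r : ℝ, 0 ≤ r → Real.exp (-c * r) ≤ C * (1 + r) ^ (-(n + 1 : ℝ)) := by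
    refine ⟨(n + 1).factorial * Real.exp c / c ^ (n + 1), fun r hr => ?_⟩
    have h1 := Real.pow_div_factorial_le_exp (c * (1 + r)) (by positivity) (n + 1)
    rw [div_le_iff₀ (by positivity), mul_pow, mul_add, mul_one, Real.exp_add] at h1
    rw [Real.rpow_neg (by positivity), ← Nat.cast_add_one, Real.rpow_natCast, neg_mul, Real.exp_neg,
      ← div_eq_mul_inv, le_div_iff₀ (by positivity), le_div_iff₀ (by positivity), inv_mul_eq_div,
      div_mul_eq_mul_div, div_le_iff₀ (by positivity)]
    linarith
  refine (h2.const_mul C).mono' (by fun_prop) (.of_forall fun x => ?_)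
  rw [Real.norm_of_nonneg (by positivity)]
  exact hC _ (norm_nonneg _)

end Tube

/-! ### Independence of the slice and Fourier inversion under Gaussian decay -/

section Shift

variable {n : ℕ}

/-- Gaussian decay in the real directions, locally uniformly in the imaginary part. -/
def HasGaussianDecay (B : Set (EuclideanSpace ℝ (Fin n))) (H : EuclideanSpace ℂ (Fin n) → ℂ) :
    Prop :=
  ∀ y₀ ∈ B, ∃ δ > 0, ∃ c > 0, ∃ M : ℝ, Metric.ball y₀ δ ⊆ B ∧
    ∀ y ∈ Metric.ball y₀ δ, ∀ x, ‖H (cpoint x y)‖ ≤ M * Real.exp (-c * ‖x‖ ^ 2)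

variable {B : Set (EuclideanSpace ℝ (Fin n))} {H : EuclideanSpace ℂ (Fin n) → ℂ}

theorem continuous_slice (hH : ContinuousOn H (tube B)) {y : EuclideanSpace ℝ (Fin n)}
    (hy : y ∈ B) : Continuous fun x => H (cpoint x y) :=
  hH.comp_continuous (continuous_cpoint_left y) fun _ => cpoint_mem_tube.2 hy

theorem HasGaussianDecay.exists_slice_le (hd : HasGaussianDecay B H) {y : EuclideanSpace ℝ (Fin n)}
    (hy : y ∈ B) : ∃ c > 0, ∃ M : ℝ, ∀ x, ‖H (cpoint x y)‖ ≤ M * Real.exp (-c * ‖x‖ ^ 2) := by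
  obtain ⟨δ, hδ, c, hc, M, -, hM⟩ := hd y hy
  exact ⟨c, hc, M, hM y (Metric.mem_ball_self hδ)⟩

theorem HasGaussianDecay.integrable_rpow_slice (hd : HasGaussianDecay B H)
    (hH : ContinuousOn H (tube B)) {y : EuclideanSpace ℝ (Fin n)} (hy : y ∈ B) {r : ℝ}
    (hr : 0 < r) : Integrable fun x => ‖H (cpoint x y)‖ ^ r := by
  obtain ⟨c, hc, M, hM⟩ := hd.exists_slice_le hy
  have hM0 : 0 ≤ M := by
    have := (norm_nonneg _).trans (hM 0)
    exact nonneg_of_mul_nonneg_left this (Real.exp_pos _)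
  refine ((integrable_exp_neg_mul_norm_sq (c := c * r) (by positivity)).const_mul (M ^ r)).mono'
    ((continuous_slice hH hy).norm.measurable.pow_const r).aestronglyMeasurable
    (.of_forall fun x => ?_)
  rw [Real.norm_of_nonneg (by positivity)]
  refine (Real.rpow_le_rpow (norm_nonneg _) (hM x) hr.le).trans (le_of_eq ?_)
  rw [Real.mul_rpow hM0 (Real.exp_pos _).le, ← Real.exp_mul]
  congr 2
  ring

theorem HasGaussianDecay.integrable_slice (hd : HasGaussianDecay B H)
    (hH : ContinuousOn H (tube B)) {y : EuclideanSpace ℝ (Fin n)} (hy : y ∈ B) :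
    Integrable fun x => H (cpoint x y) := by
  have := hd.integrable_rpow_slice hH hy one_pos
  simp only [Real.rpow_one] at this
  exact (integrable_norm_iff (continuous_slice hH hy).aestronglyMeasurable).1 this

/-- Lets the transform at a frequency `t` be treated as the plain integral of another function with
Gaussian decay. -/
theorem HasGaussianDecay.mul_exp_dot (hd : HasGaussianDecay B H) (t : EuclideanSpace ℝ (Fin n))
    (a : ℝ) : HasGaussianDecay B fun z => H z * Complex.exp (a * Complex.I * dot t z) := by
  intro y₀ hy₀
  obtain ⟨δ, hδ, c, hc, M, hB, hM⟩ := hd y₀ hy₀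
  refine ⟨δ, hδ, c, hc, M * Real.exp (|a| * (‖t‖ * (‖y₀‖ + δ))), hB, fun y hy x => ?_⟩
  have hM0 : 0 ≤ M := by
    have := (norm_nonneg _).trans (hM y hy 0)
    exact nonneg_of_mul_nonneg_left this (Real.exp_pos _)
  rw [norm_mul, norm_exp_dot]
  have h1 : -a * inner ℝ t y ≤ |a| * (‖t‖ * (‖y₀‖ + δ)) := by
    refine (le_abs_self _).trans ?_
    rw [abs_mul, abs_neg]
    gcongr
    refine (abs_real_inner_le_norm t y).trans ?_
    gcongr
    rw [Metric.mem_ball, dist_eq_norm] at hy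
    linarith [norm_le_norm_add_norm_sub' y y₀]
  calc _ ≤ M * Real.exp (-c * ‖x‖ ^ 2) * Real.exp (|a| * (‖t‖ * (‖y₀‖ + δ))) := by
        gcongr
        exact hM y hy x
    _ = _ := by ring

/-- With `y = y₀ + v`, the function `w ↦ ∫ H(x + iy₀ + wv) dx` is holomorphic near the segment from
`0` to `i`. By translation invariance it does not change under real shifts of `w`, so its complex
derivative vanishes and its values at `0` and `i` agree. No contour integral is needed. -/
theorem integral_slice_eq_of_mem_ball (hH : DifferentiableOn ℂ H (tube B))
    {y₀ : EuclideanSpace ℝ (Fin n)} {δ c M : ℝ} (hδ : 0 < δ) (hc : 0 < c)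
    (hball : Metric.ball y₀ δ ⊆ B)
    (hM : ∀ y ∈ Metric.ball y₀ δ, ∀ x, ‖H (cpoint x y)‖ ≤ M * Real.exp (-c * ‖x‖ ^ 2))
    {y : EuclideanSpace ℝ (Fin n)} (hy : y ∈ Metric.ball y₀ δ) :
    ∫ x, H (cpoint x y) = ∫ x, H (cpoint x y₀) := by
  have hM0 : 0 ≤ M := by
    have := (norm_nonneg _).trans (hM y hy 0)
    exact nonneg_of_mul_nonneg_left this (Real.exp_pos _)
  obtain ⟨v, rfl⟩ : ∃ v, y = y₀ + v := ⟨y - y₀, by abel⟩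
  rw [Metric.mem_ball, dist_eq_norm, add_sub_cancel_left] at hy
  set U : Set ℂ := Complex.re ⁻¹' Set.Ioo (-1) 1 ∩ Complex.im ⁻¹' {s | ‖s • v‖ < δ} with hU
  have hUo : IsOpen U := (isOpen_Ioo.preimage Complex.continuous_re).inter
    ((isOpen_lt (by fun_prop) continuous_const).preimage Complex.continuous_im)
  have hUc : Convex ℝ U := by
    refine ((convex_Ioo (-1 : ℝ) 1).linear_preimage Complex.reLm).inter
      (Convex.linear_preimage ?_ Complex.imLm)
    intro a ha b hb p q hp hq hpq
    have ha' : ‖a • v‖ < δ := ha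
    have hb' : ‖b • v‖ < δ := hb
    change ‖(p • a + q • b) • v‖ < δ
    have := (convex_ball (0 : EuclideanSpace ℝ (Fin n)) δ) (x := a • v) (by simpa using ha')
      (y := b • v) (by simpa using hb') hp hq hpq
    rw [mem_ball_zero_iff] at this
    rwa [add_smul, smul_assoc, smul_assoc]
  set φ : ℂ → EuclideanSpace ℝ (Fin n) → ℂ := fun w x => H (cpoint x y₀ + w • cpoint v 0) with hφ
  have hφe : ∀ w x, φ w x = H (cpoint (x + w.re • v) (y₀ + w.im • v)) := fun w x => by
    rw [cpoint_add_smul]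
  have hmem : ∀ w ∈ U, y₀ + w.im • v ∈ Metric.ball y₀ δ := fun w hw => by
    rw [Metric.mem_ball, dist_eq_norm, add_sub_cancel_left]
    exact hw.2
  have htube : ∀ w ∈ U, ∀ x, cpoint x y₀ + w • cpoint v 0 ∈ tube B := fun w hw x => by
    rw [← cpoint_add_smul]
    exact cpoint_mem_tube.2 (hball (hmem w hw))
  -- Since `|Re w| ≤ 1`, `‖x‖² ≤ 2‖x + (Re w)v‖² + 2‖v‖²`; half of the decay rate survives.
  set b : EuclideanSpace ℝ (Fin n) → ℝ := fun x =>
    M * Real.exp (c * ‖v‖ ^ 2) * Real.exp (-(c / 2) * ‖x‖ ^ 2)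
  have hb : ∀ w ∈ U, ∀ x, ‖φ w x‖ ≤ b x := fun w hw x => by
    rw [hφe]
    refine (hM _ (hmem w hw) _).trans ?_
    simp only [b]
    rw [mul_assoc, ← Real.exp_add]
    gcongr
    have h1 : ‖w.re • v‖ ≤ ‖v‖ := by
      rw [norm_smul, Real.norm_eq_abs]
      have : |w.re| ≤ 1 := abs_le.2 ⟨hw.1.1.le, hw.1.2.le⟩
      nlinarith [norm_nonneg v]
    have h2 : ‖x‖ ≤ ‖x + w.re • v‖ + ‖v‖ := by
      have := norm_sub_le (x + w.re • v) (w.re • v)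
      rw [add_sub_cancel_right] at this
      linarith
    have h3 : ‖x‖ ^ 2 ≤ 2 * ‖x + w.re • v‖ ^ 2 + 2 * ‖v‖ ^ 2 := by
      nlinarith [norm_nonneg x, norm_nonneg v, norm_nonneg (x + w.re • v),
        sq_nonneg (‖x + w.re • v‖ - ‖v‖)]
    nlinarith
  have hbi : Integrable b := (integrable_exp_neg_mul_norm_sq (by positivity)).const_mul _
  have hΦd : DifferentiableOn ℂ (fun w => ∫ x, φ w x) U := by
    refine differentiableOn_integral_of_dominated hUo (fun w hw => ?_) (fun x => ?_) hb hbi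
    · refine Continuous.aestronglyMeasurable ?_
      exact hH.continuousOn.comp_continuous ((continuous_cpoint_left y₀).add continuous_const)
        (htube w hw)
    · exact hH.comp (by fun_prop) fun w hw => htube w hw x
  have htrans : ∀ (w : ℂ) (a : ℝ), ∫ x, φ (w + a) x = ∫ x, φ w x := fun w a => by
    rw [← integral_add_right_eq_self (fun x => φ w x) (a • v)]
    refine integral_congr_ae (.of_forall fun x => ?_)
    simp only [hφe]
    simp only [Complex.add_re, Complex.ofReal_re, Complex.add_im, Complex.ofReal_im, add_zero,
      add_smul]
    congr 2
    abel
  have hderiv : U.EqOn (deriv fun w => ∫ x, φ w x) 0 := fun w hw => by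
    have h1 := (hΦd.differentiableAt (hUo.mem_nhds hw)).hasDerivAt
    have h2 : HasDerivAt (fun a : ℝ => ∫ x, φ (w + a) x) (deriv (fun w => ∫ x, φ w x) w) 0 := by
      have h3 : HasDerivAt (fun a : ℝ => w + (a : ℂ)) 1 0 :=
        (Complex.ofRealCLM.hasDerivAt (x := (0 : ℝ))).const_add w
      have h4 := HasDerivAt.scomp (g₁ := fun w => ∫ x, φ w x)
        (g₁' := deriv (fun w => ∫ x, φ w x) w) (0 : ℝ)
        (by rw [Complex.ofReal_zero, add_zero]; exact h1) h3
      rwa [one_smul] at h4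
    simp only [htrans] at h2
    exact h2.unique (hasDerivAt_const _ _)
  have h0 : (0 : ℂ) ∈ U := by simp [hU, hδ]
  have hI : Complex.I ∈ U := by simp [hU, hy]
  have := hUo.is_const_of_deriv_eq_zero hUc.isPreconnected hΦd hderiv hI h0
  simpa [hφe] using this

theorem HasGaussianDecay.integral_slice_eq (hBc : IsPreconnected B)
    (hH : DifferentiableOn ℂ H (tube B)) (hd : HasGaussianDecay B H)
    {y y' : EuclideanSpace ℝ (Fin n)} (hy : y ∈ B) (hy' : y' ∈ B) :
    ∫ x, H (cpoint x y) = ∫ x, H (cpoint x y') := by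
  refine hBc.induction₂ (fun y y' => ∫ x, H (cpoint x y) = ∫ x, H (cpoint x y')) ?_
    (fun _ _ _ _ _ _ h h' => h.trans h') (fun _ _ _ _ h => h.symm) hy hy'
  intro y₀ hy₀
  obtain ⟨δ, hδ, c, hc, M, hball, hM⟩ := hd y₀ hy₀
  refine mem_nhdsWithin_of_mem_nhds ?_
  filter_upwards [Metric.ball_mem_nhds y₀ hδ] with y hy
  exact (integral_slice_eq_of_mem_ball hH hδ hc hball hM hy).symm

/-- The Laplace–Fourier transform `t ↦ ∫ H(x + iy) e^{-2πi t·(x + iy)} dx` of the slice at `y`. -/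
noncomputable def sliceTransform (H : EuclideanSpace ℂ (Fin n) → ℂ)
    (y t : EuclideanSpace ℝ (Fin n)) : ℂ :=
  Real.exp (2 * Real.pi * inner ℝ t y) * 𝓕 (fun x => H (cpoint x y)) t

theorem integral_mul_exp_dot_eq_sliceTransform (y t : EuclideanSpace ℝ (Fin n)) :
    ∫ x, H (cpoint x y) * Complex.exp ((-2 * Real.pi : ℝ) * Complex.I * dot t (cpoint x y)) =
      sliceTransform H y t := by
  rw [sliceTransform, Real.fourier_eq, ← integral_const_mul]
  refine integral_congr_ae (.of_forall fun x => ?_)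
  simp only [dot_cpoint, Circle.smul_def, smul_eq_mul, Real.fourierChar_apply]
  rw [mul_comm (Complex.exp _) (H _), mul_left_comm, Complex.ofReal_exp, ← Complex.exp_add,
    real_inner_comm]
  congr 2
  push_cast
  linear_combination (-2 * Real.pi * (inner ℝ t y : ℂ)) * Complex.I_sq

/-- At each `t` the transform is the slice integral of the holomorphic function `H(z) e^{-2πi t·z}`,
which still has Gaussian decay. -/
theorem HasGaussianDecay.sliceTransform_eq (hBc : IsPreconnected B)
    (hH : DifferentiableOn ℂ H (tube B)) (hd : HasGaussianDecay B H)
    {y y' : EuclideanSpace ℝ (Fin n)} (hy : y ∈ B) (hy' : y' ∈ B) :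
    sliceTransform H y = sliceTransform H y' := by
  ext t
  rw [← integral_mul_exp_dot_eq_sliceTransform, ← integral_mul_exp_dot_eq_sliceTransform]
  refine (hd.mul_exp_dot t (-2 * Real.pi)).integral_slice_eq hBc ?_ hy hy'
  exact hH.mul ((((differentiable_dot t).const_mul _).cexp).differentiableOn)

theorem norm_sliceTransform_le (H : EuclideanSpace ℂ (Fin n) → ℂ)
    (y t : EuclideanSpace ℝ (Fin n)) :
    ‖sliceTransform H y t‖ ≤ Real.exp (2 * Real.pi * inner ℝ t y) * ∫ x, ‖H (cpoint x y)‖ := by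
  rw [sliceTransform, norm_mul, Complex.norm_real, Real.norm_of_nonneg (Real.exp_pos _).le]
  gcongr
  exact VectorFourier.norm_fourierIntegral_le_integral_norm _ _ _ _ _

theorem fourier_slice_eq (H : EuclideanSpace ℂ (Fin n) → ℂ) (y t : EuclideanSpace ℝ (Fin n)) :
    𝓕 (fun x => H (cpoint x y)) t =
      Real.exp (-(2 * Real.pi * inner ℝ t y)) * sliceTransform H y t := by
  rw [sliceTransform, ← mul_assoc, ← Complex.ofReal_mul, ← Real.exp_add]
  simp

theorem continuous_sliceTransform {y : EuclideanSpace ℝ (Fin n)}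
    (h : Integrable fun x => H (cpoint x y)) : Continuous (sliceTransform H y) := by
  have : Continuous (𝓕 (fun x => H (cpoint x y))) :=
    VectorFourier.fourierIntegral_continuous Real.continuous_fourierChar continuous_inner h
  unfold sliceTransform
  fun_prop

theorem HasGaussianDecay.eq_integral_sliceTransform (hBc : IsPreconnected B)
    (hH : DifferentiableOn ℂ H (tube B)) (hd : HasGaussianDecay B H)
    {y y' : EuclideanSpace ℝ (Fin n)} (hy : y ∈ B) (hy' : y' ∈ B) (x : EuclideanSpace ℝ (Fin n)) :
    H (cpoint x y) = ∫ t, sliceTransform H y' t *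
      Complex.exp (2 * Real.pi * Complex.I * dot t (cpoint x y)) := by
  have hint := hd.integrable_slice hH.continuousOn hy
  have hcF : Continuous (𝓕 (fun x => H (cpoint x y))) :=
    VectorFourier.fourierIntegral_continuous Real.continuous_fourierChar continuous_inner hint
  have hFint : Integrable (𝓕 (fun x => H (cpoint x y))) := by
    obtain ⟨δ, hδ, c, hc, M, hball, hM⟩ := hd y hy
    set J := ∫ x : EuclideanSpace ℝ (Fin n), M * Real.exp (-c * ‖x‖ ^ 2) with hJ
    have hgi : Integrable fun x : EuclideanSpace ℝ (Fin n) => M * Real.exp (-c * ‖x‖ ^ 2) :=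
      (integrable_exp_neg_mul_norm_sq hc).const_mul M
    refine ((integrable_exp_neg_mul_norm (c := 2 * Real.pi * (δ / 2)) (by positivity)).mul_const
      J).mono' hcF.aestronglyMeasurable (.of_forall fun t => ?_)
    -- Integrability of the transform comes from choosing the slice according to `t`: moving against
    -- the direction of `t` by `δ/2` gains the factor `e^{-πδ‖t‖}`. For `t = 0` the convention `0⁻¹
    -- = 0` gives `y₁ = y`.
    set y₁ := y - (δ / 2 * ‖t‖⁻¹) • t with hy₁
    have hy₁' : y₁ ∈ Metric.ball y δ := by
      rw [hy₁, Metric.mem_ball, dist_eq_norm, sub_sub_cancel_left, norm_neg, norm_smul, norm_mul,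
        norm_inv, norm_norm, Real.norm_of_nonneg (by positivity), mul_assoc]
      have : ‖t‖⁻¹ * ‖t‖ ≤ 1 := inv_mul_le_one
      nlinarith
    have hinner : inner ℝ t y₁ = inner ℝ t y - δ / 2 * ‖t‖ := by
      rw [hy₁, inner_sub_right, inner_smul_right, real_inner_self_eq_norm_sq]
      rcases eq_or_ne ‖t‖ 0 with h | h
      · simp [h]
      · field_simp
    rw [fourier_slice_eq, norm_mul, Complex.norm_real, Real.norm_of_nonneg (Real.exp_pos _).le,
      hd.sliceTransform_eq hBc hH hy (hball hy₁')]
    have h2 : ∫ x, ‖H (cpoint x y₁)‖ ≤ J :=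
      integral_mono_ae (hd.integrable_slice hH.continuousOn (hball hy₁')).norm hgi
        (.of_forall fun x => hM y₁ hy₁' x)
    calc _ ≤ Real.exp (-(2 * Real.pi * inner ℝ t y)) *
          (Real.exp (2 * Real.pi * inner ℝ t y₁) * J) := by
          gcongr
          refine (norm_sliceTransform_le _ _ _).trans ?_
          gcongr
      _ = _ := by
          rw [← mul_assoc, ← Real.exp_add, hinner]
          congr 2
          ring
  have hinv := congrFun ((continuous_slice hH.continuousOn hy).fourierInv_fourier_eq hint hFint) x
  rw [← hinv, Real.fourierInv_eq]
  refine integral_congr_ae (.of_forall fun t => ?_)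
  simp only [fourier_slice_eq, hd.sliceTransform_eq hBc hH hy hy', Circle.smul_def, smul_eq_mul,
    Real.fourierChar_apply, dot_cpoint]
  rw [← mul_assoc, mul_comm, Complex.ofReal_exp, ← Complex.exp_add]
  congr 2
  push_cast
  linear_combination (-2 * Real.pi * (inner ℝ t y : ℂ)) * Complex.I_sq

end Shift

/-! ### Local boundedness of `F` and Gaussian regularisation -/

section LocalBound

variable {n : ℕ} {B : Set (EuclideanSpace ℝ (Fin n))} {ψ : EuclideanSpace ℝ (Fin n) → ℝ}
  {F : EuclideanSpace ℂ (Fin n) → ℂ}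

theorem lintegral_mul_const_rpow {α : Type*} [MeasurableSpace α] {μ : Measure α} {h : α → ℝ≥0∞}
    {c : ℝ≥0∞} (hc : c ≠ ∞) {p : ℝ} (hp : 0 ≤ p) :
    ∫⁻ x, (h x * c) ^ p ∂μ = c ^ p * ∫⁻ x, h x ^ p ∂μ := by
  simp_rw [ENNReal.mul_rpow_of_nonneg _ _ hp, mul_comm _ (c ^ p)]
  exact lintegral_const_mul' _ _ (ENNReal.rpow_ne_top_of_nonneg hp hc)

theorem exists_exp_bound_on_ball (hB : IsOpen B) (hψ : ContinuousOn ψ B)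
    {y₀ : EuclideanSpace ℝ (Fin n)} (hy₀ : y₀ ∈ B) :
    ∃ ρ > 0, Metric.ball y₀ ρ ⊆ B ∧ ∃ K, ∀ y ∈ Metric.ball y₀ ρ, ψ y ≤ K := by
  obtain ⟨ρ, hρ, hsub⟩ := Metric.isOpen_iff.1 hB y₀ hy₀
  have hcl : Metric.closedBall y₀ (ρ / 2) ⊆ B :=
    (Metric.closedBall_subset_ball (by linarith)).trans hsub
  obtain ⟨K, hK⟩ := (isCompact_closedBall y₀ (ρ / 2)).bddAbove_image (hψ.mono hcl)
  exact ⟨ρ / 2, by positivity, Metric.ball_subset_closedBall.trans hcl, K, fun y hy =>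
    hK ⟨y, Metric.ball_subset_closedBall hy, rfl⟩⟩

/-- All that is kept of the norm for local purposes: `ψ` is bounded above on small balls, so the
weight can be dropped there. The exponent is `min s (1/p)`, or `1/p` when `s = ∞`; the condition `r
≤ 1/p` gives `pr ≤ 1`, as the sub-mean-value inequality requires. -/
theorem exists_lintegral_slice_rpow_lt_top (hB : IsOpen B) (hψ : ContinuousOn ψ B)
    {p : ℝ} (hp : 1 ≤ p) {s : ℝ≥0∞} (hs : 0 < s) (hF : bergmanNorm B ψ p s F < ∞) :
    ∃ r > 0, r ≤ 1 / p ∧ ∀ y₀ ∈ B, ∃ ρ > 0, Metric.ball y₀ ρ ⊆ B ∧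
      ∫⁻ y in Metric.ball y₀ ρ, (∫⁻ x, ‖F (cpoint x y)‖ₑ ^ p) ^ r < ∞ := by
  have hp0 : 0 < p := by linarith
  by_cases hst : s = ∞
  · refine ⟨1 / p, by positivity, le_rfl, fun y₀ hy₀ => ?_⟩
    obtain ⟨ρ, hρ, hsub, K, hK⟩ := exists_exp_bound_on_ball hB hψ hy₀
    refine ⟨ρ, hρ, hsub, ?_⟩
    set N := bergmanNorm B ψ p s F with hN
    rw [bergmanNorm, if_pos hst] at hN
    have hle : ∀ y ∈ Metric.ball y₀ ρ, (∫⁻ x, ‖F (cpoint x y)‖ₑ ^ p) ^ (1 / p) ≤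
        ENNReal.ofReal (Real.exp (2 * Real.pi * K)) * N := by
      intro y hy
      have h1 : ENNReal.ofReal (Real.exp (-2 * Real.pi * ψ y)) *
          (∫⁻ x, ‖F (cpoint x y)‖ₑ ^ p) ^ (1 / p) ≤ N := by
        rw [hN]
        exact le_iSup₂ (f := fun y _ => ENNReal.ofReal (Real.exp (-2 * Real.pi * ψ y)) *
          (∫⁻ x, ‖F (cpoint x y)‖ₑ ^ p) ^ (1 / p)) y (hsub hy)
      calc (∫⁻ x, ‖F (cpoint x y)‖ₑ ^ p) ^ (1 / p)
          = ENNReal.ofReal (Real.exp (2 * Real.pi * ψ y)) *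
            (ENNReal.ofReal (Real.exp (-2 * Real.pi * ψ y)) *
              (∫⁻ x, ‖F (cpoint x y)‖ₑ ^ p) ^ (1 / p)) := by
            rw [← mul_assoc, ← ENNReal.ofReal_mul (Real.exp_pos _).le, ← Real.exp_add]
            simp
        _ ≤ _ := by
            gcongr
            exact hK y hy
    refine (setLIntegral_mono' measurableSet_ball hle).trans_lt ?_
    rw [setLIntegral_const]
    exact ENNReal.mul_lt_top (ENNReal.mul_lt_top ENNReal.ofReal_lt_top hF) measure_ball_lt_top
  · have hs0 : 0 < s.toReal := ENNReal.toReal_pos hs.ne' hst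
    refine ⟨min s.toReal (1 / p), by positivity, min_le_right _ _, fun y₀ hy₀ => ?_⟩
    obtain ⟨ρ, hρ, hsub, K, hK⟩ := exists_exp_bound_on_ball hB hψ hy₀
    refine ⟨ρ, hρ, hsub, ?_⟩
    rw [bergmanNorm, if_neg hst, ENNReal.rpow_lt_top_iff_of_pos (by positivity)] at hF
    set C := (ENNReal.ofReal (Real.exp (2 * Real.pi * K)) ^ p) ^ s.toReal with hC
    have hCt : C ≠ ∞ := ENNReal.rpow_ne_top_of_nonneg hs0.le
      (ENNReal.rpow_ne_top_of_nonneg hp0.le ENNReal.ofReal_ne_top)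
    have hle : ∀ y ∈ Metric.ball y₀ ρ, (∫⁻ x, ‖F (cpoint x y)‖ₑ ^ p) ^ min s.toReal (1 / p) ≤
        1 + C * (∫⁻ x, (‖F (cpoint x y)‖ₑ *
          ENNReal.ofReal (Real.exp (-2 * Real.pi * ψ y))) ^ p) ^ s.toReal := by
      intro y hy
      set g := ∫⁻ x, ‖F (cpoint x y)‖ₑ ^ p with hg
      have h1 : g ^ min s.toReal (1 / p) ≤ 1 + g ^ s.toReal := by
        rcases le_total g 1 with h | h
        · exact (ENNReal.rpow_le_one h (by positivity)).trans le_self_add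
        · exact (ENNReal.rpow_le_rpow_of_exponent_le h (min_le_left _ _)).trans le_add_self
      refine h1.trans ?_
      gcongr
      rw [hC, ← ENNReal.mul_rpow_of_nonneg _ _ hs0.le]
      gcongr
      rw [lintegral_mul_const_rpow ENNReal.ofReal_ne_top hp0.le, ← hg, ← mul_assoc,
        ← ENNReal.mul_rpow_of_nonneg _ _ hp0.le, ← ENNReal.ofReal_mul (Real.exp_pos _).le,
        ← Real.exp_add]
      refine le_mul_of_one_le_left zero_le (ENNReal.one_le_rpow ?_ hp0)
      rw [ENNReal.one_le_ofReal, Real.one_le_exp_iff]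
      nlinarith [hK y hy, Real.pi_pos]
    refine (setLIntegral_mono' measurableSet_ball hle).trans_lt ?_
    rw [lintegral_add_left measurable_const, setLIntegral_const, one_mul,
      lintegral_const_mul' _ _ hCt]
    refine ENNReal.add_lt_top.2 ⟨measure_ball_lt_top, ENNReal.mul_lt_top hCt.lt_top ?_⟩
    exact (lintegral_mono_set hsub).trans_lt hF

/-- Apply the sub-mean-value inequality to `|F|^{pr}` on balls of fixed radius in `ℂⁿ`, enlarged to
products of real balls. Hölder in `x` turns the inner integral into `(∫ |F|^p dx)^r` up to a
constant, and the resulting bound does not involve the centre `x`. -/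
theorem exists_norm_slice_le (hB : IsOpen B) (hF : DifferentiableOn ℂ F (tube B)) {p r : ℝ}
    (hp : 1 ≤ p) (hr : 0 < r) (hrp : r ≤ 1 / p) {y₀ : EuclideanSpace ℝ (Fin n)} {ρ : ℝ}
    (hρ : 0 < ρ) (hsub : Metric.ball y₀ ρ ⊆ B)
    (hfin : ∫⁻ y in Metric.ball y₀ ρ, (∫⁻ x, ‖F (cpoint x y)‖ₑ ^ p) ^ r < ∞) :
    ∃ M : ℝ, ∀ y ∈ Metric.ball y₀ (ρ / 2), ∀ x, ‖F (cpoint x y)‖ ≤ M := by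
  classical
  have hp0 : 0 < p := by linarith
  have hr1 : r ≤ 1 := hrp.trans (by rw [div_le_one hp0]; exact hp)
  have hσ1 : p * r ≤ 1 := by
    rw [le_div_iff₀ hp0] at hrp
    linarith
  have hσ : 0 < p * r := by positivity
  -- As `1/2 + 1/3 < 1`, balls of radius `ρ/3` centred over `ball y₀ (ρ/2)` remain in the tube over
  -- `ball y₀ ρ`.
  obtain ⟨C, hC, hmean⟩ := exists_enorm_rpow_le_mul_lintegral (complexVolume n) hσ hσ1
    (δ := ρ / 3) (by positivity)
  set I := ∫⁻ y in Metric.ball y₀ ρ, (∫⁻ x, ‖F (cpoint x y)‖ₑ ^ p) ^ r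
  set m := volume (Metric.ball (0 : EuclideanSpace ℝ (Fin n)) (ρ / 3))
  have hm : m ≠ ∞ := measure_ball_lt_top.ne
  set G : EuclideanSpace ℂ (Fin n) → ℂ := (tube B).piecewise F 0 with hG
  have hGm : Measurable G := hF.continuousOn.measurable_piecewise continuousOn_const
    (isOpen_tube hB).measurableSet
  have hGF : ∀ z ∈ tube B, G z = F z := fun z hz => Set.piecewise_eq_of_mem _ _ _ hz
  have hGc : Measurable fun w : EuclideanSpace ℝ (Fin n) × EuclideanSpace ℝ (Fin n) =>
      ‖G (cpoint w.1 w.2)‖ₑ ^ (p * r) :=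
    (hGm.comp continuous_cpoint.measurable).enorm.pow_const _
  set D := C * (m ^ (1 - r) * I) with hD
  have hDt : D ≠ ∞ := ENNReal.mul_ne_top hC (ENNReal.mul_ne_top
    (ENNReal.rpow_ne_top_of_nonneg (by linarith) hm) hfin.ne)
  have hkey : ∀ y ∈ Metric.ball y₀ (ρ / 2), ∀ x, ‖F (cpoint x y)‖ₑ ^ (p * r) ≤ D := by
    intro y hy x
    have hyB : Metric.ball y (ρ / 3) ⊆ Metric.ball y₀ ρ := fun y' hy' => by
      rw [Metric.mem_ball] at *
      linarith [dist_triangle y' y y₀]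
    have htube : ∀ z ∈ Metric.closedBall (cpoint x y) (ρ / 3), z ∈ tube B := by
      intro z hz
      obtain ⟨w, rfl⟩ := (cpointAddEquiv n).surjective z
      have h := (mem_ball_of_cpoint_mem_ball
        (Metric.closedBall_subset_ball (by linarith : ρ / 3 < ρ / 2) hz)).2
      refine cpoint_mem_tube.2 (hsub ?_)
      rw [Metric.mem_ball] at *
      linarith [dist_triangle w.2 y y₀]
    refine (hmean F (cpoint x y) (hF.mono htube)).trans ?_
    rw [hD]
    gcongr
    have hball : ∀ z : EuclideanSpace ℝ (Fin n), volume (Metric.ball z (ρ / 3)) = m := fun z =>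
      Measure.addHaar_ball_center _ _ _
    calc ∫⁻ v in Metric.ball (cpoint x y) (ρ / 3), ‖F v‖ₑ ^ (p * r) ∂complexVolume n
        = ∫⁻ v in Metric.ball (cpoint x y) (ρ / 3), ‖G v‖ₑ ^ (p * r) ∂complexVolume n :=
          setLIntegral_congr_fun measurableSet_ball fun v hv => by
            rw [hGF v (htube v (Metric.ball_subset_closedBall hv))]
      _ = ∫⁻ w in cpointAddEquiv n ⁻¹' Metric.ball (cpoint x y) (ρ / 3),
            ‖G (cpoint w.1 w.2)‖ₑ ^ (p * r) ∂(volume.prod volume) :=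
          setLIntegral_map measurableSet_ball (hGm.enorm.pow_const _) continuous_cpoint.measurable
      _ ≤ ∫⁻ w in Metric.ball x (ρ / 3) ×ˢ Metric.ball y (ρ / 3),
            ‖G (cpoint w.1 w.2)‖ₑ ^ (p * r) ∂(volume.prod volume) :=
          lintegral_mono_set fun w hw => mem_ball_of_cpoint_mem_ball hw
      _ = ∫⁻ y' in Metric.ball y (ρ / 3), ∫⁻ x' in Metric.ball x (ρ / 3),
            ‖G (cpoint x' y')‖ₑ ^ (p * r) := by
          rw [← Measure.prod_restrict, lintegral_prod_symm' _ hGc]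
      _ ≤ ∫⁻ y' in Metric.ball y (ρ / 3), m ^ (1 - r) * (∫⁻ x, ‖F (cpoint x y')‖ₑ ^ p) ^ r := by
          refine setLIntegral_mono' measurableSet_ball fun y' hy' => ?_
          have hGF' : ∀ x', G (cpoint x' y') = F (cpoint x' y') := fun x' =>
            hGF _ (cpoint_mem_tube.2 (hsub (hyB hy')))
          simp only [hGF', ENNReal.rpow_mul]
          have hc := continuous_slice hF.continuousOn (hsub (hyB hy'))
          refine (lintegral_rpow_le_measure_rpow_mul hr hr1
            (hc.measurable.enorm.pow_const p).aemeasurable).trans ?_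
          rw [Measure.restrict_apply_univ, hball]
          gcongr
          exact Measure.restrict_le_self
      _ = m ^ (1 - r) * ∫⁻ y' in Metric.ball y (ρ / 3), (∫⁻ x, ‖F (cpoint x y')‖ₑ ^ p) ^ r :=
          lintegral_const_mul' _ _ (ENNReal.rpow_ne_top_of_nonneg (by linarith) hm)
      _ ≤ m ^ (1 - r) * I := by
          gcongr
          exact lintegral_mono_set hyB
  refine ⟨(D ^ (1 / (p * r))).toReal, fun y hy x => ?_⟩
  have h := ENNReal.rpow_le_rpow (hkey y hy x) (z := 1 / (p * r)) (by positivity)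
  rw [← ENNReal.rpow_mul, mul_one_div_cancel hσ.ne', ENNReal.rpow_one] at h
  have := ENNReal.toReal_mono (ENNReal.rpow_ne_top_of_nonneg (by positivity) hDt) h
  rwa [toReal_enorm] at this

/-- The product of `F` with the Gaussian factor `exp (-ε (z₁² + ⋯ + zₙ²))`. -/
noncomputable def regularize (F : EuclideanSpace ℂ (Fin n) → ℂ) (ε : ℝ)
    (z : EuclideanSpace ℂ (Fin n)) : ℂ :=
  F z * Complex.exp (-ε * sumSq z)

theorem differentiableOn_regularize (hF : DifferentiableOn ℂ F (tube B)) (ε : ℝ) :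
    DifferentiableOn ℂ (regularize F ε) (tube B) :=
  hF.mul ((differentiable_sumSq.const_mul _).cexp).differentiableOn

theorem norm_regularize_cpoint (F : EuclideanSpace ℂ (Fin n) → ℂ) (ε : ℝ)
    (x y : EuclideanSpace ℝ (Fin n)) : ‖regularize F ε (cpoint x y)‖ =
      ‖F (cpoint x y)‖ * Real.exp (-ε * (‖x‖ ^ 2 - ‖y‖ ^ 2)) := by
  rw [regularize, norm_mul, norm_exp_sumSq]

theorem norm_regularize_cpoint_le (F : EuclideanSpace ℂ (Fin n) → ℂ) {ε : ℝ} (hε : 0 ≤ ε)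
    (x y : EuclideanSpace ℝ (Fin n)) : ‖regularize F ε (cpoint x y)‖ ≤
      Real.exp (ε * ‖y‖ ^ 2) * ‖F (cpoint x y)‖ := by
  rw [norm_regularize_cpoint, mul_comm]
  refine mul_le_mul_of_nonneg_right (Real.exp_le_exp.2 ?_) (norm_nonneg _)
  nlinarith [mul_nonneg hε (sq_nonneg ‖x‖)]

/-- The factor has modulus `e^{-ε(‖x‖² - ‖y‖²)}`: Gaussian in `x`, and bounded locally in `y`. -/
theorem hasGaussianDecay_regularize
    (hF : ∀ y₀ ∈ B, ∃ δ > 0, ∃ M : ℝ, Metric.ball y₀ δ ⊆ B ∧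
      ∀ y ∈ Metric.ball y₀ δ, ∀ x, ‖F (cpoint x y)‖ ≤ M) {ε : ℝ} (hε : 0 < ε) :
    HasGaussianDecay B (regularize F ε) := by
  intro y₀ hy₀
  obtain ⟨δ, hδ, M, hsub, hM⟩ := hF y₀ hy₀
  refine ⟨δ, hδ, ε, hε, M * Real.exp (ε * (‖y₀‖ + δ) ^ 2), hsub, fun y hy x => ?_⟩
  have hM0 : 0 ≤ M := (norm_nonneg _).trans (hM y hy 0)
  rw [norm_regularize_cpoint, mul_assoc, ← Real.exp_add]
  gcongr
  · exact hM y hy x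
  · rw [Metric.mem_ball, dist_eq_norm] at hy
    have h1 : ‖y‖ ≤ ‖y₀‖ + δ := by linarith [norm_le_norm_add_norm_sub' y y₀]
    have h2 : ‖y‖ ^ 2 ≤ (‖y₀‖ + δ) ^ 2 := by gcongr
    nlinarith

theorem tendsto_regularize (F : EuclideanSpace ℂ (Fin n) → ℂ) (z : EuclideanSpace ℂ (Fin n)) :
    Filter.Tendsto (fun k : ℕ => regularize F (1 / ((k : ℝ) + 1)) z) Filter.atTop (nhds (F z)) := by
  have h : Continuous fun ε : ℝ => regularize F ε z := by
    unfold regularize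
    fun_prop
  have := (h.tendsto 0).comp (tendsto_one_div_add_atTop_nhds_zero_nat (𝕜 := ℝ))
  simpa [regularize, Function.comp_def] using this

/-- Otherwise the integrand would be infinite on a ball of positive measure. This makes the set of
`p`-integrable slices dense in `B`. -/
theorem exists_slice_lt_top {p r : ℝ} (hr : 0 < r) {y₀ : EuclideanSpace ℝ (Fin n)} {ρ δ : ℝ}
    (hρ : 0 < ρ) (hδ : 0 < δ)
    (hfin : ∫⁻ y in Metric.ball y₀ ρ, (∫⁻ x, ‖F (cpoint x y)‖ₑ ^ p) ^ r < ∞) :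
    ∃ y ∈ Metric.ball y₀ δ, ∫⁻ x, ‖F (cpoint x y)‖ₑ ^ p < ∞ := by
  by_contra! hcon
  have h1 : ∫⁻ y in Metric.ball y₀ (min ρ δ), (∫⁻ x, ‖F (cpoint x y)‖ₑ ^ p) ^ r = ∞ := by
    rw [setLIntegral_congr_fun (g := fun _ => ∞) measurableSet_ball fun y hy => by
      simp [top_le_iff.1 (hcon y (Metric.ball_subset_ball (min_le_right _ _) hy)), hr],
      setLIntegral_const, ENNReal.top_mul]
    exact (Metric.measure_ball_pos _ _ (by positivity)).ne'
  refine (h1.ge.trans (lintegral_mono_set (Metric.ball_subset_ball (min_le_left _ _)))).not_gt hfin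

end LocalBound

/-! ### Removing the Gaussian factor when `p = 1` -/

section Limit

variable {n : ℕ} {B : Set (EuclideanSpace ℝ (Fin n))}
  {F : EuclideanSpace ℂ (Fin n) → ℂ}

/-- Shifting `y` by `-(δ/2)v`, with `v` close to the direction of `t`, makes `e^{-2π t·y}` gain
exponential decay. By compactness finitely many `v` serve all `t`, and the shifted points can be
moved slightly into `S`, the only slices under control. -/
theorem exists_finset_exp_inner_le {S : Set (EuclideanSpace ℝ (Fin n))}
    {y : EuclideanSpace ℝ (Fin n)} {δ : ℝ} (hδ : 0 < δ) (hS : Metric.ball y δ ⊆ closure S) :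
    ∃ c > 0, ∃ T : Finset (EuclideanSpace ℝ (Fin n)), ↑T ⊆ S ∧ ∀ t,
      Real.exp (-(2 * Real.pi * inner ℝ t y)) ≤
        ∑ y' ∈ T, Real.exp (-c * ‖t‖) * Real.exp (-(2 * Real.pi * inner ℝ t y')) := by
  classical
  obtain ⟨N, hN, hNfin, hcov⟩ := (isCompact_closedBall (0 : EuclideanSpace ℝ (Fin n)) 1
    ).finite_cover_balls (e := 1 / 4) (by norm_num)
  have hg : ∀ v ∈ N, ∃ y' ∈ S, dist (y - (δ / 2) • v) y' < δ / 8 := fun v hv => by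
    refine Metric.mem_closure_iff.1 (hS ?_) _ (by positivity)
    have := hN hv
    rw [mem_closedBall_zero_iff] at this
    rw [Metric.mem_ball, dist_eq_norm, sub_sub_cancel_left, norm_neg, norm_smul,
      Real.norm_of_nonneg (by positivity)]
    nlinarith
  choose! g hgS hgd using hg
  -- The gain is `δ/2 · 3/4` from the direction, less `δ/8` from the approximation: `δ/4`.
  refine ⟨2 * Real.pi * (δ / 4), by positivity, hNfin.toFinset.image g, ?_, fun t => ?_⟩
  · intro y' hy'
    obtain ⟨v, hv, rfl⟩ := Finset.mem_image.1 (Finset.mem_coe.1 hy')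
    exact hgS v (hNfin.mem_toFinset.1 hv)
  obtain ⟨v, hvN, hv⟩ : ∃ v ∈ N, dist (‖t‖⁻¹ • t) v < 1 / 4 := by
    have : ‖t‖⁻¹ • t ∈ Metric.closedBall (0 : EuclideanSpace ℝ (Fin n)) 1 := by
      rw [mem_closedBall_zero_iff, norm_smul, norm_inv, norm_norm]
      exact inv_mul_le_one
    simpa using hcov this
  refine le_trans ?_ (Finset.single_le_sum (f := fun y' => Real.exp (-(2 * Real.pi * (δ / 4)) * ‖t‖) *
    Real.exp (-(2 * Real.pi * inner ℝ t y'))) (fun _ _ => by positivity)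
    (Finset.mem_image_of_mem g (hNfin.mem_toFinset.2 hvN)))
  rw [← Real.exp_add]
  gcongr
  have ht0 := norm_nonneg t
  have h1 : inner ℝ t (‖t‖⁻¹ • t) = ‖t‖ := by
    rw [inner_smul_right, real_inner_self_eq_norm_sq]
    rcases eq_or_ne ‖t‖ 0 with h | h
    · simp [h]
    · field_simp
  have h2 : inner ℝ t (‖t‖⁻¹ • t) - inner ℝ t v ≤ ‖t‖ * (1 / 4) := by
    rw [← inner_sub_right]
    refine (real_inner_le_norm _ _).trans ?_
    rw [dist_eq_norm] at hv
    gcongr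
  have h3 : -(inner ℝ t (y - (δ / 2) • v) - inner ℝ t (g v)) ≤ ‖t‖ * (δ / 8) := by
    rw [← inner_sub_right]
    refine (neg_le_abs _).trans ((abs_real_inner_le_norm _ _).trans ?_)
    have := hgd v hvN
    rw [dist_eq_norm] at this
    gcongr
  rw [inner_sub_right, inner_smul_right] at h3
  have h4 : ‖t‖ * (δ / 4) ≤ inner ℝ t y - inner ℝ t (g v) := by
    nlinarith
  nlinarith [Real.pi_pos]

theorem inv_natCast_add_one_pos (k : ℕ) : (0 : ℝ) < 1 / ((k : ℝ) + 1) := Nat.one_div_pos_of_nat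

theorem norm_regularize_inv_le (F : EuclideanSpace ℂ (Fin n) → ℂ) (k : ℕ)
    (x y : EuclideanSpace ℝ (Fin n)) : ‖regularize F (1 / ((k : ℝ) + 1)) (cpoint x y)‖ ≤
      Real.exp (‖y‖ ^ 2) * ‖F (cpoint x y)‖ := by
  refine (norm_regularize_cpoint_le F (inv_natCast_add_one_pos k).le x y).trans ?_
  gcongr
  have : (1 : ℝ) / ((k : ℝ) + 1) ≤ 1 := by
    rw [div_le_one (by positivity)]
    linarith [(Nat.cast_nonneg k : (0 : ℝ) ≤ k)]
  nlinarith [sq_nonneg ‖y‖]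

theorem norm_exp_dot_cpoint (t x y : EuclideanSpace ℝ (Fin n)) :
    ‖Complex.exp (2 * Real.pi * Complex.I * dot t (cpoint x y))‖ =
      Real.exp (-(2 * Real.pi * inner ℝ t y)) := by
  have := norm_exp_dot t x y (2 * Real.pi)
  push_cast at this
  rw [this, neg_mul]

theorem continuous_exp_dot (z : EuclideanSpace ℂ (Fin n)) :
    Continuous fun t => Complex.exp (2 * Real.pi * Complex.I * dot t z) := by
  unfold dot
  fun_prop

theorem tendsto_sliceTransform_regularize (hF : ContinuousOn F (tube B))
    {y : EuclideanSpace ℝ (Fin n)} (hy : y ∈ B) (hint : Integrable fun x => F (cpoint x y))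
    (t : EuclideanSpace ℝ (Fin n)) :
    Filter.Tendsto (fun k : ℕ => sliceTransform (regularize F (1 / ((k : ℝ) + 1))) y t)
      Filter.atTop (nhds (sliceTransform F y t)) := by
  simp only [← integral_mul_exp_dot_eq_sliceTransform]
  have hce : Continuous fun x =>
      Complex.exp ((-2 * Real.pi : ℝ) * Complex.I * dot t (cpoint x y)) := by
    have := (differentiable_dot t).continuous.comp (continuous_cpoint_left y)
    fun_prop
  refine tendsto_integral_of_dominated_convergence (fun x =>
    Real.exp (‖y‖ ^ 2) * ‖F (cpoint x y)‖ * Real.exp (-(-2 * Real.pi) * inner ℝ t y))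
    (fun k => ?_) ((hint.norm.const_mul _).mul_const _) (fun k => .of_forall fun x => ?_)
    (.of_forall fun x => (tendsto_regularize F _).mul_const _)
  · refine Continuous.aestronglyMeasurable (Continuous.mul ?_ hce)
    have hreg : ContinuousOn (regularize F (1 / ((k : ℝ) + 1))) (tube B) :=
      hF.mul ((differentiable_sumSq.const_mul _).cexp).continuous.continuousOn
    exact continuous_slice hreg hy
  · rw [norm_mul, norm_exp_dot]
    gcongr
    exact norm_regularize_inv_le F k x y

/-- The case `p = 1`: the transforms of the integrable slices agree and represent `F`. -/
theorem exists_continuous_representation (hBo : IsOpen B) (hBc : IsPreconnected B)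
    (hF : DifferentiableOn ℂ F (tube B))
    (hbd : ∀ y₀ ∈ B, ∃ δ > 0, ∃ M : ℝ, Metric.ball y₀ δ ⊆ B ∧
      ∀ y ∈ Metric.ball y₀ δ, ∀ x, ‖F (cpoint x y)‖ ≤ M)
    {S : Set (EuclideanSpace ℝ (Fin n))} (hSB : S ⊆ B) (hS : B ⊆ closure S) (hne : B.Nonempty)
    (hSi : ∀ y ∈ S, Integrable fun x => F (cpoint x y)) :
    ∃ f : EuclideanSpace ℝ (Fin n) → ℂ, Continuous f ∧
      (∀ y ∈ S, ∀ t, ‖f t‖ ≤ Real.exp (2 * Real.pi * inner ℝ t y) * ∫ x, ‖F (cpoint x y)‖) ∧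
      ∀ z ∈ tube B, Integrable (fun t => f t * Complex.exp (2 * Real.pi * Complex.I * dot t z)) ∧
        F z = ∫ t, f t * Complex.exp (2 * Real.pi * Complex.I * dot t z) := by
  obtain ⟨y₁, hy₁⟩ : S.Nonempty := closure_nonempty_iff.1 (hne.mono hS)
  have hdec : ∀ k : ℕ, HasGaussianDecay B (regularize F (1 / ((k : ℝ) + 1))) := fun k =>
    hasGaussianDecay_regularize hbd (inv_natCast_add_one_pos k)
  have hdiff : ∀ k : ℕ, DifferentiableOn ℂ (regularize F (1 / ((k : ℝ) + 1))) (tube B) :=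
    fun k => differentiableOn_regularize hF _
  set f := sliceTransform F y₁ with hf
  set fk : ℕ → EuclideanSpace ℝ (Fin n) → ℂ := fun k =>
    sliceTransform (regularize F (1 / ((k : ℝ) + 1))) y₁ with hfk
  have hfky : ∀ y ∈ B, ∀ k, fk k = sliceTransform (regularize F (1 / ((k : ℝ) + 1))) y :=
    fun y hy k => (hdec k).sliceTransform_eq hBc (hdiff k) (hSB hy₁) hy
  have hlim : ∀ t, Filter.Tendsto (fun k => fk k t) Filter.atTop (nhds (f t)) := fun t =>
    tendsto_sliceTransform_regularize hF.continuousOn (hSB hy₁) (hSi y₁ hy₁) t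
  -- Independence of the slice passes from the regularisations to `F` in the limit, between slices
  -- over `S`.
  have hfy : ∀ y ∈ S, f = sliceTransform F y := fun y hy => by
    ext t
    refine tendsto_nhds_unique (hlim t) ?_
    simp only [hfky y (hSB hy)]
    exact tendsto_sliceTransform_regularize hF.continuousOn (hSB hy) (hSi y hy) t
  have hfc : Continuous f := continuous_sliceTransform (hSi y₁ hy₁)
  have hfkb : ∀ y ∈ S, ∀ k t, ‖fk k t‖ * Real.exp (-(2 * Real.pi * inner ℝ t y)) ≤
      Real.exp (‖y‖ ^ 2) * ∫ x, ‖F (cpoint x y)‖ := by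
    intro y hy k t
    rw [hfky y (hSB hy), Real.exp_neg, ← div_eq_mul_inv, div_le_iff₀ (Real.exp_pos _),
      mul_comm _ (Real.exp (2 * _ * _))]
    refine (norm_sliceTransform_le _ _ _).trans ?_
    gcongr
    rw [← integral_const_mul]
    exact integral_mono_ae ((hdec k).integrable_slice (hdiff k).continuousOn (hSB hy)).norm
      ((hSi y hy).norm.const_mul _) (.of_forall fun x => norm_regularize_inv_le F k x y)
  refine ⟨f, hfc, fun y hy t => ?_, ?_⟩
  · rw [hfy y hy]
    exact norm_sliceTransform_le _ _ _
  rintro _ ⟨x, y, hy, rfl⟩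
  obtain ⟨δ, hδ, hball⟩ := Metric.isOpen_iff.1 hBo y hy
  obtain ⟨c, hc, T, hTS, hT⟩ := exists_finset_exp_inner_le hδ (hball.trans hS)
  set D := ∑ y' ∈ T, Real.exp (‖y'‖ ^ 2) * ∫ x, ‖F (cpoint x y')‖ with hD
  -- A majorant independent of `k`: the bounds at the finitely many `y' ∈ T` supply `D`, and the
  -- factor gained supplies integrability.
  have hbk : ∀ k t, ‖fk k t * Complex.exp (2 * Real.pi * Complex.I * dot t (cpoint x y))‖ ≤
      Real.exp (-c * ‖t‖) * D := by
    intro k t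
    rw [norm_mul, norm_exp_dot_cpoint, hD, Finset.mul_sum]
    calc ‖fk k t‖ * Real.exp (-(2 * Real.pi * inner ℝ t y))
        ≤ ‖fk k t‖ * ∑ y' ∈ T, Real.exp (-c * ‖t‖) * Real.exp (-(2 * Real.pi * inner ℝ t y')) := by
          gcongr
          exact hT t
      _ = ∑ y' ∈ T, Real.exp (-c * ‖t‖) *
            (‖fk k t‖ * Real.exp (-(2 * Real.pi * inner ℝ t y'))) := by
          rw [Finset.mul_sum]
          exact Finset.sum_congr rfl fun _ _ => by ring
      _ ≤ _ := by
          refine Finset.sum_le_sum fun y' hy' => ?_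
          exact mul_le_mul_of_nonneg_left (hfkb y' (hTS hy') k t) (Real.exp_pos _).le
  have hbi : Integrable fun t : EuclideanSpace ℝ (Fin n) => Real.exp (-c * ‖t‖) * D :=
    (integrable_exp_neg_mul_norm hc).mul_const D
  have hlim' : ∀ t, Filter.Tendsto (fun k => fk k t *
      Complex.exp (2 * Real.pi * Complex.I * dot t (cpoint x y))) Filter.atTop
      (nhds (f t * Complex.exp (2 * Real.pi * Complex.I * dot t (cpoint x y)))) := fun t =>
    (hlim t).mul_const _
  refine ⟨hbi.mono' (hfc.mul (continuous_exp_dot _)).aestronglyMeasurable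
    (.of_forall fun t => le_of_tendsto' (hlim' t).norm fun k => hbk k t), ?_⟩
  refine tendsto_nhds_unique (tendsto_regularize F (cpoint x y)) ?_
  simp only [fun k : ℕ => (hdec k).eq_integral_sliceTransform hBc (hdiff k) hy (hSB hy₁) x]
  refine tendsto_integral_of_dominated_convergence _ (fun k => ?_) hbi
    (fun k => .of_forall (hbk k)) (.of_forall hlim')
  exact ((continuous_sliceTransform ((hdec k).integrable_slice (hdiff k).continuousOn
    (hSB hy₁))).mul (continuous_exp_dot _)).aestronglyMeasurable

end Limit

/-! ### Limits in `L^q` of the transforms when `1 < p ≤ 2` -/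

section LqLimit

variable {n : ℕ} {B : Set (EuclideanSpace ℝ (Fin n))}
  {F : EuclideanSpace ℂ (Fin n) → ℂ}

theorem HasGaussianDecay.sub {H K : EuclideanSpace ℂ (Fin n) → ℂ} (hH : HasGaussianDecay B H)
    (hK : HasGaussianDecay B K) : HasGaussianDecay B fun z => H z - K z := by
  intro y₀ hy₀
  obtain ⟨δ₁, hδ₁, c₁, hc₁, M₁, hB₁, hM₁⟩ := hH y₀ hy₀
  obtain ⟨δ₂, hδ₂, c₂, hc₂, M₂, hB₂, hM₂⟩ := hK y₀ hy₀
  have key : ∀ {c : ℝ}, min c₁ c₂ ≤ c → ∀ {M u : ℝ}, 0 ≤ u → ∀ x : EuclideanSpace ℝ (Fin n),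
      u ≤ M * Real.exp (-c * ‖x‖ ^ 2) → u ≤ M * Real.exp (-min c₁ c₂ * ‖x‖ ^ 2) := by
    intro c hc M u hu x h
    have hM0 : 0 ≤ M := nonneg_of_mul_nonneg_left (hu.trans h) (Real.exp_pos _)
    refine h.trans ?_
    gcongr
  refine ⟨min δ₁ δ₂, by positivity, min c₁ c₂, by positivity, M₁ + M₂,
    (Metric.ball_subset_ball (min_le_left _ _)).trans hB₁, fun y hy x => ?_⟩
  have h1 := key (min_le_left _ _) (norm_nonneg _) x
    (hM₁ y (Metric.ball_subset_ball (min_le_left _ _) hy) x)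
  have h2 := key (min_le_right _ _) (norm_nonneg _) x
    (hM₂ y (Metric.ball_subset_ball (min_le_right _ _) hy) x)
  linarith [norm_sub_le (H (cpoint x y)) (K (cpoint x y))]

theorem eLpNorm_ofReal_eq {α : Type*} [MeasurableSpace α] {μ : Measure α} {p : ℝ} (hp : 0 < p)
    (g : α → ℂ) : eLpNorm g (ENNReal.ofReal p) μ = (∫⁻ x, ‖g x‖ₑ ^ p ∂μ) ^ (1 / p) := by
  rw [eLpNorm_eq_lintegral_rpow_enorm_toReal (by simpa) ENNReal.ofReal_ne_top,
    ENNReal.toReal_ofReal hp.le]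

theorem HasGaussianDecay.eLpNorm_fourier_slice_le {H : EuclideanSpace ℂ (Fin n) → ℂ} {p q : ℝ}
    (hpq : p.HolderConjugate q) (hp2 : p ≤ 2) (hd : HasGaussianDecay B H)
    (hH : ContinuousOn H (tube B)) {y : EuclideanSpace ℝ (Fin n)} (hy : y ∈ B) :
    eLpNorm (𝓕 fun x => H (cpoint x y)) (ENNReal.ofReal q) volume ≤
      eLpNorm (fun x => H (cpoint x y)) (ENNReal.ofReal p) volume := by
  have hp := hpq.pos
  rw [eLpNorm_ofReal_eq hpq.symm.pos, eLpNorm_ofReal_eq hp]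
  exact lintegral_fourier_rpow_le hpq hp2 (continuous_slice hH hy).measurable
    (hd.integrable_rpow_slice hH hy (by positivity)) (hd.integrable_rpow_slice hH hy hp)

theorem tendsto_eLpNorm_regularize_sub (hF : ContinuousOn F (tube B)) {p : ℝ} (hp : 0 < p)
    {y : EuclideanSpace ℝ (Fin n)} (hy : y ∈ B) (hfin : ∫⁻ x, ‖F (cpoint x y)‖ₑ ^ p < ∞) :
    Filter.Tendsto (fun k : ℕ => eLpNorm (fun x => regularize F (1 / ((k : ℝ) + 1)) (cpoint x y) -
      F (cpoint x y)) (ENNReal.ofReal p) volume) Filter.atTop (nhds 0) := by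
  have hc := continuous_slice hF hy
  have hck : ∀ k : ℕ, Continuous fun x => regularize F (1 / ((k : ℝ) + 1)) (cpoint x y) := fun k =>
    continuous_slice (hF.mul ((differentiable_sumSq.const_mul _).cexp).continuous.continuousOn) hy
  simp only [eLpNorm_ofReal_eq hp]
  set A := ENNReal.ofReal (Real.exp (‖y‖ ^ 2) + 1) ^ p with hA
  have hAt : A ≠ ∞ := ENNReal.rpow_ne_top_of_nonneg hp.le ENNReal.ofReal_ne_top
  have h := tendsto_lintegral_of_dominated_convergence (μ := volume)
    (F := fun (k : ℕ) x => ‖regularize F (1 / ((k : ℝ) + 1)) (cpoint x y) - F (cpoint x y)‖ₑ ^ p)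
    (f := fun _ => 0) (fun x => A * ‖F (cpoint x y)‖ₑ ^ p)
    (fun k => ((hck k).sub hc).measurable.enorm.pow_const p) (fun k => .of_forall fun x => ?_) ?_
    (.of_forall fun x => ?_)
  · rw [lintegral_zero] at h
    have h2 := (ENNReal.continuous_rpow_const (y := 1 / p)).tendsto 0 |>.comp h
    rw [ENNReal.zero_rpow_of_pos (by positivity)] at h2
    exact h2
  · simp only [hA]
    rw [← ENNReal.mul_rpow_of_nonneg _ _ hp.le]
    gcongr
    rw [← ofReal_norm, ← ofReal_norm, ← ENNReal.ofReal_mul (by positivity)]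
    refine ENNReal.ofReal_le_ofReal ?_
    have := norm_regularize_inv_le F k x y
    linarith [norm_sub_le (regularize F (1 / ((k : ℝ) + 1)) (cpoint x y)) (F (cpoint x y))]
  · rw [lintegral_const_mul' _ _ hAt]
    exact ENNReal.mul_ne_top hAt hfin.ne
  · have h1 := (tendsto_regularize F (cpoint x y)).sub_const (F (cpoint x y))
    rw [sub_self] at h1
    have h2 := (ENNReal.continuous_rpow_const (y := p)).tendsto _ |>.comp h1.enorm
    rw [enorm_zero, ENNReal.zero_rpow_of_pos hp] at h2
    exact h2

theorem eLpNorm_regularize_le (F : EuclideanSpace ℂ (Fin n) → ℂ) {p : ℝ≥0∞} (k : ℕ)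
    (y : EuclideanSpace ℝ (Fin n)) :
    eLpNorm (fun x => regularize F (1 / ((k : ℝ) + 1)) (cpoint x y)) p volume ≤
      ENNReal.ofReal (Real.exp (1 / ((k : ℝ) + 1) * ‖y‖ ^ 2)) *
        eLpNorm (fun x => F (cpoint x y)) p volume :=
  eLpNorm_le_mul_eLpNorm_of_ae_le_mul (.of_forall fun x =>
    norm_regularize_cpoint_le F (inv_natCast_add_one_pos k).le x y) p

/-- The regularised slices converge in `L^p`; Hausdorff–Young applied to their differences makes the
transforms Cauchy in `L^q`. The limit `u` plays the part of the Fourier transform of the slice,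
which need not be integrable. -/
theorem exists_tendsto_eLpNorm_fourier_slice (hF : DifferentiableOn ℂ F (tube B))
    (hbd : ∀ y₀ ∈ B, ∃ δ > 0, ∃ M : ℝ, Metric.ball y₀ δ ⊆ B ∧
      ∀ y ∈ Metric.ball y₀ δ, ∀ x, ‖F (cpoint x y)‖ ≤ M)
    {p q : ℝ} (hpq : p.HolderConjugate q) (hp2 : p ≤ 2) {y : EuclideanSpace ℝ (Fin n)}
    (hy : y ∈ B) (hfin : ∫⁻ x, ‖F (cpoint x y)‖ₑ ^ p < ∞) :
    ∃ u : EuclideanSpace ℝ (Fin n) → ℂ, StronglyMeasurable u ∧ Filter.Tendsto (fun k : ℕ =>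
      eLpNorm (fun t => 𝓕 (fun x => regularize F (1 / ((k : ℝ) + 1)) (cpoint x y)) t - u t)
        (ENNReal.ofReal q) volume) Filter.atTop (nhds 0) := by
  have hp := hpq.pos
  have hq := hpq.symm.pos
  have : Fact (1 ≤ ENNReal.ofReal p) := ⟨by simpa using hpq.lt.le⟩
  have : Fact (1 ≤ ENNReal.ofReal q) := ⟨by simpa using hpq.symm.lt.le⟩
  set Fk : ℕ → EuclideanSpace ℂ (Fin n) → ℂ := fun k => regularize F (1 / ((k : ℝ) + 1)) with hFk
  have hdec : ∀ k : ℕ, HasGaussianDecay B (Fk k) := fun k =>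
    hasGaussianDecay_regularize hbd (inv_natCast_add_one_pos k)
  have hdiff : ∀ k : ℕ, ContinuousOn (Fk k) (tube B) :=
    fun k => (differentiableOn_regularize hF _).continuousOn
  have hi : ∀ k, Integrable fun x => Fk k (cpoint x y) := fun k =>
    (hdec k).integrable_slice (hdiff k) hy
  have hFp : MemLp (fun x => F (cpoint x y)) (ENNReal.ofReal p) volume := by
    refine ⟨(continuous_slice hF.continuousOn hy).aestronglyMeasurable, ?_⟩
    rw [eLpNorm_ofReal_eq hp]
    exact ENNReal.rpow_lt_top_of_nonneg (by positivity) hfin.ne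
  have hFkp : ∀ k, MemLp (fun x => Fk k (cpoint x y)) (ENNReal.ofReal p) volume := fun k =>
    ⟨(continuous_slice (hdiff k) hy).aestronglyMeasurable, (eLpNorm_regularize_le F k y).trans_lt
      (ENNReal.mul_lt_top ENNReal.ofReal_lt_top hFp.2)⟩
  have hFkq : ∀ k, MemLp (𝓕 fun x => Fk k (cpoint x y)) (ENNReal.ofReal q) volume := fun k =>
    ⟨(VectorFourier.fourierIntegral_continuous Real.continuous_fourierChar continuous_inner
      (hi k)).aestronglyMeasurable,
      ((hdec k).eLpNorm_fourier_slice_le hpq hp2 (hdiff k) hy).trans_lt (hFkp k).2⟩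
  have hv : CauchySeq fun k => (hFkp k).toLp := by
    refine Filter.Tendsto.cauchySeq (x := hFp.toLp) ?_
    rw [Lp.tendsto_Lp_iff_tendsto_eLpNorm'']
    exact tendsto_eLpNorm_regularize_sub hF.continuousOn hp hy hfin
  have hle : ∀ k l, dist (hFkq k).toLp (hFkq l).toLp ≤ dist (hFkp k).toLp (hFkp l).toLp := by
    intro k l
    rw [dist_edist, dist_edist, Lp.edist_toLp_toLp, Lp.edist_toLp_toLp]
    refine ENNReal.toReal_mono ((hFkp k).sub (hFkp l)).2.ne ?_
    have h := ((hdec k).sub (hdec l)).eLpNorm_fourier_slice_le hpq hp2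
      ((hdiff k).sub (hdiff l)) hy
    refine le_trans (le_of_eq ?_) h
    congr 1
    ext t
    rw [Pi.sub_apply, Real.fourier_eq, Real.fourier_eq, Real.fourier_eq, ← integral_sub]
    · refine integral_congr_ae (.of_forall fun x => ?_)
      simp only [smul_sub]
    · exact (Real.fourierIntegral_convergent_iff t).2 (hi k)
    · exact (Real.fourierIntegral_convergent_iff t).2 (hi l)
  have hu : CauchySeq fun k => (hFkq k).toLp := by
    rw [Metric.cauchySeq_iff] at hv ⊢
    intro ε hε
    obtain ⟨N, hN⟩ := hv ε hε
    exact ⟨N, fun k hk l hl => (hle k l).trans_lt (hN k hk l hl)⟩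
  obtain ⟨U, hU⟩ := cauchySeq_tendsto_of_complete hu
  refine ⟨U, Lp.stronglyMeasurable U, ?_⟩
  rw [Lp.tendsto_Lp_iff_tendsto_eLpNorm'] at hU
  refine hU.congr fun k => eLpNorm_congr_ae ?_
  filter_upwards [(hFkq k).coeFn_toLp] with t ht
  rw [Pi.sub_apply, ht]

/-- The factor `e` may be unbounded, so it cannot be carried through a norm limit; almost everywhere
convergence along a common subsequence is used instead. It identifies the limits obtained on
different slices. -/
theorem ae_eq_of_tendsto_eLpNorm_sub {α : Type*} [MeasurableSpace α] {μ : Measure α} {q : ℝ≥0∞}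
    (hq : q ≠ 0) {v w : ℕ → α → ℂ} {a b : α → ℂ} {e : α → ℂ}
    (hvm : ∀ k, AEStronglyMeasurable (v k) μ) (ham : AEStronglyMeasurable a μ)
    (hwm : ∀ k, AEStronglyMeasurable (w k) μ) (hbm : AEStronglyMeasurable b μ)
    (hv : Filter.Tendsto (fun k => eLpNorm (v k - a) q μ) Filter.atTop (nhds 0))
    (hw : Filter.Tendsto (fun k => eLpNorm (w k - b) q μ) Filter.atTop (nhds 0))
    (hvw : ∀ k x, w k x = e x * v k x) : ∀ᵐ x ∂μ, b x = e x * a x := by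
  obtain ⟨i, hi, hi'⟩ := (tendstoInMeasure_of_tendsto_eLpNorm hq hvm ham hv).exists_seq_tendsto_ae
  obtain ⟨j, hj, hj'⟩ := (tendstoInMeasure_of_tendsto_eLpNorm hq (fun k => hwm (i k)) hbm
    (hw.comp hi.tendsto_atTop)).exists_seq_tendsto_ae
  filter_upwards [hi', hj'] with x hx hx'
  refine tendsto_nhds_unique hx' ?_
  simp only [hvw]
  exact (hx.comp hj.tendsto_atTop).const_mul _

/-- Hölder: `e^{-c‖t‖}` goes into `L^p` and each weighted `g` into `L^q`. -/
theorem eLpNorm_mul_exp_dot_le {p q : ℝ} (hpq : p.HolderConjugate q)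
    {x y : EuclideanSpace ℝ (Fin n)} {c : ℝ} {T : Finset (EuclideanSpace ℝ (Fin n))}
    (hT : ∀ t, Real.exp (-(2 * Real.pi * inner ℝ t y)) ≤
      ∑ y' ∈ T, Real.exp (-c * ‖t‖) * Real.exp (-(2 * Real.pi * inner ℝ t y')))
    {g : EuclideanSpace ℝ (Fin n) → ℂ} (hg : AEStronglyMeasurable g) :
    eLpNorm (fun t => g t * Complex.exp (2 * Real.pi * Complex.I * dot t (cpoint x y))) 1 volume ≤
      ∑ y' ∈ T, eLpNorm (fun t : EuclideanSpace ℝ (Fin n) => Real.exp (-c * ‖t‖))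
        (ENNReal.ofReal p) volume *
        eLpNorm (fun t => (Real.exp (-(2 * Real.pi * inner ℝ t y')) : ℂ) * g t)
          (ENNReal.ofReal q) volume := by
  have : ENNReal.HolderConjugate (ENNReal.ofReal p) (ENNReal.ofReal q) := hpq.ennrealOfReal
  have hm : ∀ y', AEStronglyMeasurable fun t =>
      (Real.exp (-(2 * Real.pi * inner ℝ t y')) : ℂ) * g t := fun y' =>
    (Continuous.aestronglyMeasurable (by fun_prop)).mul hg
  have he : AEStronglyMeasurable (fun t : EuclideanSpace ℝ (Fin n) => Real.exp (-c * ‖t‖)) volume :=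
    Continuous.aestronglyMeasurable (by fun_prop)
  calc _ ≤ eLpNorm (∑ y' ∈ T, fun t => Real.exp (-c * ‖t‖) *
        ‖(Real.exp (-(2 * Real.pi * inner ℝ t y')) : ℂ) * g t‖) 1 volume := by
        refine eLpNorm_mono_real fun t => ?_
        rw [norm_mul, norm_exp_dot_cpoint, Finset.sum_apply]
        refine (mul_le_mul_of_nonneg_left (hT t) (norm_nonneg _)).trans (le_of_eq ?_)
        rw [Finset.mul_sum]
        refine Finset.sum_congr rfl fun y' _ => ?_
        rw [norm_mul, Complex.norm_real, Real.norm_of_nonneg (Real.exp_pos _).le]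
        ring
    _ ≤ ∑ y' ∈ T, eLpNorm (fun t => Real.exp (-c * ‖t‖) *
        ‖(Real.exp (-(2 * Real.pi * inner ℝ t y')) : ℂ) * g t‖) 1 volume :=
        eLpNorm_sum_le (fun y' _ => he.mul (hm y').norm) le_rfl
    _ ≤ _ := by
        refine Finset.sum_le_sum fun y' _ => ?_
        have h := eLpNorm_smul_le_mul_eLpNorm (r := 1) (p := ENNReal.ofReal p)
          (q := ENNReal.ofReal q) (hm y').norm he
        rw [eLpNorm_norm] at h
        exact h

end LqLimit

/-! ### The integral representation when `1 < p ≤ 2` -/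

section Representation

variable {n : ℕ} {B : Set (EuclideanSpace ℝ (Fin n))}
  {F : EuclideanSpace ℂ (Fin n) → ℂ}

/-- The case `1 < p ≤ 2`: a single function `f` whose weighted versions are the Fourier transforms
of all `p`-integrable slices, and which represents `F`. -/
theorem exists_measurable_representation (hBo : IsOpen B) (hBc : IsPreconnected B)
    (hF : DifferentiableOn ℂ F (tube B))
    (hbd : ∀ y₀ ∈ B, ∃ δ > 0, ∃ M : ℝ, Metric.ball y₀ δ ⊆ B ∧
      ∀ y ∈ Metric.ball y₀ δ, ∀ x, ‖F (cpoint x y)‖ ≤ M)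
    {p q : ℝ} (hpq : p.HolderConjugate q) (hp2 : p ≤ 2)
    {S : Set (EuclideanSpace ℝ (Fin n))} (hSB : S ⊆ B) (hS : B ⊆ closure S) (hne : B.Nonempty)
    (hSi : ∀ y ∈ S, ∫⁻ x, ‖F (cpoint x y)‖ₑ ^ p < ∞) :
    ∃ f : EuclideanSpace ℝ (Fin n) → ℂ, Measurable f ∧
      (∀ y ∈ S, eLpNorm (fun t => (Real.exp (-(2 * Real.pi * inner ℝ t y)) : ℂ) * f t)
          (ENNReal.ofReal q) volume ≤
        eLpNorm (fun x => F (cpoint x y)) (ENNReal.ofReal p) volume) ∧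
      ∀ z ∈ tube B, Integrable (fun t => f t * Complex.exp (2 * Real.pi * Complex.I * dot t z)) ∧
        F z = ∫ t, f t * Complex.exp (2 * Real.pi * Complex.I * dot t z) := by
  have hp := hpq.pos
  have hq := hpq.symm.pos
  obtain ⟨y₁, hy₁⟩ : S.Nonempty := closure_nonempty_iff.1 (hne.mono hS)
  have hdec : ∀ k : ℕ, HasGaussianDecay B (regularize F (1 / ((k : ℝ) + 1))) := fun k =>
    hasGaussianDecay_regularize hbd (inv_natCast_add_one_pos k)
  have hdiff : ∀ k : ℕ, DifferentiableOn ℂ (regularize F (1 / ((k : ℝ) + 1))) (tube B) :=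
    fun k => differentiableOn_regularize hF _
  obtain ⟨u, hum, hu⟩ := exists_tendsto_eLpNorm_fourier_slice hF hbd hpq hp2 (hSB hy₁) (hSi y₁ hy₁)
  set f : EuclideanSpace ℝ (Fin n) → ℂ :=
    fun t => (Real.exp (2 * Real.pi * inner ℝ t y₁) : ℂ) * u t with hf
  have hfm : Measurable f := by
    have h1 : Continuous fun t : EuclideanSpace ℝ (Fin n) =>
      (Real.exp (2 * Real.pi * inner ℝ t y₁) : ℂ) := by fun_prop
    exact h1.measurable.mul hum.measurable
  set fk : ℕ → EuclideanSpace ℝ (Fin n) → ℂ := fun k =>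
    sliceTransform (regularize F (1 / ((k : ℝ) + 1))) y₁ with hfk
  have hfourier : ∀ y ∈ B, ∀ (k : ℕ) t, 𝓕 (fun x => regularize F (1 / ((k : ℝ) + 1)) (cpoint x y)) t =
      (Real.exp (-(2 * Real.pi * inner ℝ t y)) : ℂ) * fk k t := fun y hy k t => by
    rw [fourier_slice_eq, (hdec k).sliceTransform_eq hBc (hdiff k) hy (hSB hy₁)]
  have hfkc : ∀ k, Continuous (fk k) := fun k =>
    continuous_sliceTransform ((hdec k).integrable_slice (hdiff k).continuousOn (hSB hy₁))
  have hwc : ∀ y, Continuous fun t : EuclideanSpace ℝ (Fin n) =>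
      (Real.exp (-(2 * Real.pi * inner ℝ t y)) : ℂ) := fun y => by fun_prop
  have hlim : ∀ y ∈ S, Filter.Tendsto (fun k => eLpNorm
      (fun t => (Real.exp (-(2 * Real.pi * inner ℝ t y)) : ℂ) * (fk k t - f t))
      (ENNReal.ofReal q) volume) Filter.atTop (nhds 0) := by
    intro y hy
    obtain ⟨w, hwm, hw⟩ := exists_tendsto_eLpNorm_fourier_slice hF hbd hpq hp2 (hSB hy) (hSi y hy)
    simp only [hfourier y (hSB hy)] at hw
    simp only [hfourier y₁ (hSB hy₁)] at hu
    have hcancel : ∀ t, (Real.exp (2 * Real.pi * inner ℝ t y₁) : ℂ) *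
        (Real.exp (-(2 * Real.pi * inner ℝ t y₁)) : ℂ) = 1 := fun t => by
      rw [← Complex.ofReal_mul, ← Real.exp_add, add_neg_cancel, Real.exp_zero, Complex.ofReal_one]
    -- The regularised transforms at `y` and `y₁` differ by an explicit exponential, hence so do
    -- their limits; one `f` thus serves all slices over `S`.
    have hae : ∀ᵐ t, w t = ((Real.exp (-(2 * Real.pi * inner ℝ t y)) : ℂ) *
        (Real.exp (2 * Real.pi * inner ℝ t y₁) : ℂ)) * u t := by
      refine ae_eq_of_tendsto_eLpNorm_sub (q := ENNReal.ofReal q) (by simpa using hq)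
        (fun k => ((hwc y₁).mul (hfkc k)).aestronglyMeasurable) hum.aestronglyMeasurable
        (fun k => ((hwc y).mul (hfkc k)).aestronglyMeasurable) hwm.aestronglyMeasurable hu hw
        fun k t => ?_
      simp only [Pi.mul_apply]
      linear_combination (-(Real.exp (-(2 * Real.pi * inner ℝ t y)) : ℂ) * fk k t) * hcancel t
    refine hw.congr fun k => eLpNorm_congr_ae ?_
    filter_upwards [hae] with t ht
    rw [ht, hf]
    ring
  have hnorm : ∀ y ∈ S, eLpNorm (fun t => (Real.exp (-(2 * Real.pi * inner ℝ t y)) : ℂ) * f t)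
      (ENNReal.ofReal q) volume ≤
      eLpNorm (fun x => F (cpoint x y)) (ENNReal.ofReal p) volume := by
    intro y hy
    -- The factor `e^{‖y‖²/(k+1)}` tends to `1`. The cruder `e^{‖y‖²}` would spoil the constant of
    -- the norm inequality.
    have h1 : ∀ k : ℕ, eLpNorm (fun t => (Real.exp (-(2 * Real.pi * inner ℝ t y)) : ℂ) * f t)
          (ENNReal.ofReal q) volume ≤
        ENNReal.ofReal (Real.exp (1 / ((k : ℝ) + 1) * ‖y‖ ^ 2)) *
          eLpNorm (fun x => F (cpoint x y)) (ENNReal.ofReal p) volume +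
        eLpNorm (fun t => (Real.exp (-(2 * Real.pi * inner ℝ t y)) : ℂ) * (fk k t - f t))
          (ENNReal.ofReal q) volume := by
      intro k
      have h2 : (fun t => (Real.exp (-(2 * Real.pi * inner ℝ t y)) : ℂ) * f t) =
          (fun t => (Real.exp (-(2 * Real.pi * inner ℝ t y)) : ℂ) * fk k t) -
          fun t => (Real.exp (-(2 * Real.pi * inner ℝ t y)) : ℂ) * (fk k t - f t) := by
        ext t
        simp only [Pi.sub_apply]
        ring
      rw [h2]
      refine (eLpNorm_sub_le ((hwc y).mul (hfkc k)).aestronglyMeasurable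
        ((hwc y).aestronglyMeasurable.mul ((hfkc k).aestronglyMeasurable.sub
          hfm.aestronglyMeasurable)) (by simpa using hpq.symm.lt.le)).trans ?_
      refine add_le_add ?_ le_rfl
      have h3 : (fun t => (Real.exp (-(2 * Real.pi * inner ℝ t y)) : ℂ)) * fk k =
          𝓕 fun x => regularize F (1 / ((k : ℝ) + 1)) (cpoint x y) :=
        funext fun t => (hfourier y (hSB hy) k t).symm
      rw [h3]
      exact ((hdec k).eLpNorm_fourier_slice_le hpq hp2 (hdiff k).continuousOn (hSB hy)).trans
        (eLpNorm_regularize_le F k y)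
    have h3 : Filter.Tendsto (fun k : ℕ => ENNReal.ofReal (Real.exp (1 / ((k : ℝ) + 1) * ‖y‖ ^ 2)))
        Filter.atTop (nhds 1) := by
      have h4 : Continuous fun ε : ℝ => ENNReal.ofReal (Real.exp (ε * ‖y‖ ^ 2)) :=
        ENNReal.continuous_ofReal.comp (by fun_prop)
      have h5 := (h4.tendsto 0).comp (tendsto_one_div_add_atTop_nhds_zero_nat (𝕜 := ℝ))
      simpa [Function.comp_def] using h5
    have h6 := (ENNReal.Tendsto.mul_const (b := eLpNorm (fun x => F (cpoint x y))
      (ENNReal.ofReal p) volume) h3 (.inl one_ne_zero)).add (hlim y hy)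
    rw [one_mul, add_zero] at h6
    exact ge_of_tendsto' h6 h1
  refine ⟨f, hfm, hnorm, ?_⟩
  rintro _ ⟨x, y, hy, rfl⟩
  obtain ⟨δ, hδ, hball⟩ := Metric.isOpen_iff.1 hBo y hy
  obtain ⟨c, hc, T, hTS, hT⟩ := exists_finset_exp_inner_le hδ (hball.trans hS)
  have hexp : eLpNorm (fun t : EuclideanSpace ℝ (Fin n) => Real.exp (-c * ‖t‖))
      (ENNReal.ofReal p) volume ≠ ∞ := by
    rw [eLpNorm_eq_lintegral_rpow_enorm_toReal (by simpa using hp) ENNReal.ofReal_ne_top,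
      ENNReal.toReal_ofReal hp.le]
    refine ENNReal.rpow_ne_top_of_nonneg (by positivity) ?_
    have h := (integrable_exp_neg_mul_norm (n := n) (c := c * p) (by positivity)).2
    rw [hasFiniteIntegral_iff_enorm] at h
    refine ne_of_lt (lt_of_eq_of_lt (lintegral_congr fun t => ?_) h)
    rw [Real.enorm_of_nonneg (Real.exp_pos _).le, Real.enorm_of_nonneg (Real.exp_pos _).le,
      ENNReal.ofReal_rpow_of_pos (Real.exp_pos _), ← Real.exp_mul]
    congr 2
    ring
  -- The inversion integrals converge in `L¹` at every `y ∈ B`, since convergence is known in `L^q`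
  -- at each of the finitely many `y' ∈ T`.
  have hconv : Filter.Tendsto (fun k => eLpNorm (fun t => (fk k t - f t) *
      Complex.exp (2 * Real.pi * Complex.I * dot t (cpoint x y))) 1 volume) Filter.atTop
      (nhds 0) := by
    have h1 := tendsto_finsetSum T fun y' hy' =>
      ENNReal.Tendsto.const_mul (a := eLpNorm (fun t : EuclideanSpace ℝ (Fin n) =>
        Real.exp (-c * ‖t‖)) (ENNReal.ofReal p) volume) (hlim y' (hTS hy')) (.inr hexp)
    simp only [mul_zero, Finset.sum_const_zero] at h1
    exact tendsto_of_tendsto_of_tendsto_of_le_of_le tendsto_const_nhds h1 (fun _ => zero_le)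
      fun k => eLpNorm_mul_exp_dot_le hpq hT
        ((hfkc k).aestronglyMeasurable.sub hfm.aestronglyMeasurable)
  have hfm' : AEStronglyMeasurable fun t => f t *
      Complex.exp (2 * Real.pi * Complex.I * dot t (cpoint x y)) :=
    hfm.aestronglyMeasurable.mul (continuous_exp_dot _).aestronglyMeasurable
  have hfint : Integrable fun t => f t *
      Complex.exp (2 * Real.pi * Complex.I * dot t (cpoint x y)) := by
    rw [← memLp_one_iff_integrable]
    refine ⟨hfm', (eLpNorm_mul_exp_dot_le hpq hT hfm.aestronglyMeasurable).trans_lt ?_⟩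
    refine ENNReal.sum_lt_top.2 fun y' hy' => ENNReal.mul_lt_top hexp.lt_top ?_
    refine (hnorm y' (hTS hy')).trans_lt ?_
    rw [eLpNorm_ofReal_eq hp]
    exact ENNReal.rpow_lt_top_of_nonneg (by positivity) (hSi y' (hTS hy')).ne
  refine ⟨hfint, tendsto_nhds_unique (tendsto_regularize F (cpoint x y)) ?_⟩
  simp only [fun k : ℕ => (hdec k).eq_integral_sliceTransform hBc (hdiff k) hy (hSB hy₁) x]
  have hconv' : Filter.Tendsto (fun k => eLpNorm ((fun t => fk k t *
      Complex.exp (2 * Real.pi * Complex.I * dot t (cpoint x y))) - fun t => f t *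
      Complex.exp (2 * Real.pi * Complex.I * dot t (cpoint x y))) 1 volume) Filter.atTop
      (nhds 0) := by
    refine hconv.congr fun k => ?_
    congr 1
    ext t
    simp only [Pi.sub_apply, sub_mul]
  refine tendsto_integral_of_L1' _ hfm' ?_ hconv'
  filter_upwards [hconv'.eventually (gt_mem_nhds ENNReal.zero_lt_top)] with k hk
  have h1 : Integrable ((fun t => fk k t *
      Complex.exp (2 * Real.pi * Complex.I * dot t (cpoint x y))) - fun t => f t *
      Complex.exp (2 * Real.pi * Complex.I * dot t (cpoint x y))) :=
    memLp_one_iff_integrable.1 ⟨((hfkc k).mul (continuous_exp_dot _)).aestronglyMeasurable.sub hfm',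
      hk⟩
  have h2 := h1.add hfint
  rwa [sub_add_cancel] at h2

end Representation

/-! ### Norm inequalities and the support of `f` -/

section Weights

variable {n : ℕ} {B : Set (EuclideanSpace ℝ (Fin n))} {ψ : EuclideanSpace ℝ (Fin n) → ℝ}
  {F : EuclideanSpace ℂ (Fin n) → ℂ} {f : EuclideanSpace ℝ (Fin n) → ℂ}

theorem ofReal_exp_inner_add (y t : EuclideanSpace ℝ (Fin n)) (a : ℝ) :
    ENNReal.ofReal (Real.exp (-2 * Real.pi * (inner ℝ y t + a))) =
      ENNReal.ofReal (Real.exp (-(2 * Real.pi * inner ℝ t y))) *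
        ENNReal.ofReal (Real.exp (-2 * Real.pi * a)) := by
  rw [← ENNReal.ofReal_mul (Real.exp_pos _).le, ← Real.exp_add, real_inner_comm]
  congr 2
  ring

theorem lintegral_mul_exp_rpow (f : EuclideanSpace ℝ (Fin n) → ℂ) {q : ℝ} (hq : 0 < q)
    (y : EuclideanSpace ℝ (Fin n)) (a : ℝ) :
    ∫⁻ t, (‖f t‖ₑ * ENNReal.ofReal (Real.exp (-2 * Real.pi * (inner ℝ y t + a)))) ^ q =
      (eLpNorm (fun t => (Real.exp (-(2 * Real.pi * inner ℝ t y)) : ℂ) * f t)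
          (ENNReal.ofReal q) volume * ENNReal.ofReal (Real.exp (-2 * Real.pi * a))) ^ q := by
  simp only [ofReal_exp_inner_add, ← mul_assoc]
  rw [lintegral_mul_const_rpow ENNReal.ofReal_ne_top hq.le, ENNReal.mul_rpow_of_nonneg _ _ hq.le,
    mul_comm, eLpNorm_ofReal_eq hq, ← ENNReal.rpow_mul, one_div_mul_cancel hq.ne',
    ENNReal.rpow_one]
  congr 1
  refine lintegral_congr fun t => ?_
  rw [enorm_mul, ← ofReal_norm (Complex.ofReal _), Complex.norm_real,
    Real.norm_of_nonneg (Real.exp_pos _).le, mul_comm]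

theorem lintegral_slice_mul_exp_rpow (F : EuclideanSpace ℂ (Fin n) → ℂ) {p : ℝ} (hp : 0 < p)
    (y : EuclideanSpace ℝ (Fin n)) (a : ℝ) :
    ∫⁻ x, (‖F (cpoint x y)‖ₑ * ENNReal.ofReal (Real.exp a)) ^ p =
      (ENNReal.ofReal (Real.exp a) * (∫⁻ x, ‖F (cpoint x y)‖ₑ ^ p) ^ (1 / p)) ^ p := by
  rw [lintegral_mul_const_rpow ENNReal.ofReal_ne_top hp.le, ENNReal.mul_rpow_of_nonneg _ _ hp.le,
    ← ENNReal.rpow_mul, one_div_mul_cancel hp.ne', ENNReal.rpow_one]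

/-- On a slice `e^{-2πψ(y)}` is a constant, so the slicewise inequality can be weighted and then
integrated, or its supremum taken, in `y`. -/
theorem mixedNorm_le_bergmanNorm {p q : ℝ} (hp : 0 < p) (hq : 0 < q) (s : ℝ≥0∞)
    (h : ∀ y ∈ B, eLpNorm (fun t => (Real.exp (-(2 * Real.pi * inner ℝ t y)) : ℂ) * f t)
      (ENNReal.ofReal q) volume ≤ (∫⁻ x, ‖F (cpoint x y)‖ₑ ^ p) ^ (1 / p)) (hB : MeasurableSet B) :
    mixedNorm B ψ p q s f ≤ bergmanNorm B ψ p s F := by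
  unfold mixedNorm bergmanNorm
  split_ifs with hs
  · refine iSup₂_mono fun y hy => ?_
    rw [lintegral_mul_exp_rpow f hq, ← ENNReal.rpow_mul, mul_one_div_cancel hq.ne',
      ENNReal.rpow_one, mul_comm]
    gcongr
    exact h y hy
  · refine ENNReal.rpow_le_rpow (setLIntegral_mono' hB fun y hy => ?_) (by positivity)
    rw [lintegral_mul_exp_rpow f hq, lintegral_slice_mul_exp_rpow F hp, ← ENNReal.rpow_mul,
      ← ENNReal.rpow_mul, mul_div_cancel₀ _ hq.ne', mul_comm p, mul_comm (ENNReal.ofReal _)]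
    gcongr
    exact h y hy

theorem enorm_mul_weightNorm_le {s : ℝ≥0∞} (hs : 0 < s) (hB : MeasurableSet B)
    {t : EuclideanSpace ℝ (Fin n)}
    (h : ∀ y ∈ B, ‖f t‖ₑ * ENNReal.ofReal (Real.exp (-(2 * Real.pi * inner ℝ t y))) ≤
      ∫⁻ x, ‖F (cpoint x y)‖ₑ) :
    ‖f t‖ₑ * weightNorm B ψ s t ≤ bergmanNorm B ψ 1 s F := by
  unfold weightNorm bergmanNorm
  split_ifs with hst
  · simp only [ENNReal.mul_iSup]
    refine iSup₂_mono fun y hy => ?_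
    rw [ofReal_exp_inner_add, ← mul_assoc, mul_comm]
    simp only [ENNReal.rpow_one, div_one]
    gcongr
    exact h y hy
  · have hs0 : 0 < s.toReal := ENNReal.toReal_pos hs.ne' hst
    have h1 : ‖f t‖ₑ = (‖f t‖ₑ ^ s.toReal) ^ (1 / s.toReal) := by
      rw [← ENNReal.rpow_mul, mul_one_div_cancel hs0.ne', ENNReal.rpow_one]
    rw [h1, ← ENNReal.mul_rpow_of_nonneg _ _ (by positivity), mul_one,
      ← lintegral_const_mul' _ _ (ENNReal.rpow_ne_top_of_nonneg hs0.le enorm_ne_top)]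
    refine ENNReal.rpow_le_rpow (setLIntegral_mono' hB fun y hy => ?_) (by positivity)
    have h2 : ENNReal.ofReal (Real.exp (-2 * s.toReal * Real.pi * (inner ℝ y t + ψ y))) =
        ENNReal.ofReal (Real.exp (-2 * Real.pi * (inner ℝ y t + ψ y))) ^ s.toReal := by
      rw [ENNReal.ofReal_rpow_of_pos (Real.exp_pos _), ← Real.exp_mul]
      congr 2
      ring
    rw [h2, ← ENNReal.mul_rpow_of_nonneg _ _ hs0.le, ofReal_exp_inner_add, ← mul_assoc]
    gcongr
    simp only [ENNReal.rpow_one]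
    rw [lintegral_mul_const' _ _ ENNReal.ofReal_ne_top]
    gcongr
    exact h y hy

theorem mem_weightSet_of_weightNorm_lt_top {s : ℝ≥0∞} (hs : 0 < s)
    {t : EuclideanSpace ℝ (Fin n)} (h : weightNorm B ψ s t < ∞) : t ∈ weightSet B ψ s := by
  unfold weightNorm at h
  unfold weightSet
  split_ifs at h ⊢ with hst
  · refine ⟨-Real.log (⨆ y ∈ B, ENNReal.ofReal (Real.exp (-2 * Real.pi * (inner ℝ y t + ψ y)))
      ).toReal / (2 * Real.pi), ?_⟩
    rintro _ ⟨y, hy, rfl⟩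
    have h1 := ENNReal.toReal_mono h.ne (le_iSup₂ (f := fun y (_ : y ∈ B) =>
      ENNReal.ofReal (Real.exp (-2 * Real.pi * (inner ℝ y t + ψ y)))) y hy)
    rw [ENNReal.toReal_ofReal (Real.exp_pos _).le] at h1
    have h2 := Real.log_le_log (Real.exp_pos _) h1
    rw [Real.log_exp, real_inner_comm] at h2
    rw [div_le_iff₀ (by positivity)]
    linarith
  · have hs0 : 0 < s.toReal := ENNReal.toReal_pos hs.ne' hst
    rw [ENNReal.rpow_lt_top_iff_of_pos (by positivity)] at h
    refine lt_of_eq_of_lt (lintegral_congr fun y => ?_) h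
    rw [real_inner_comm]
    congr 2
    ring

theorem measurable_weight {ψ' : EuclideanSpace ℝ (Fin n) → ℝ} (hψ' : Measurable ψ') (a : ℝ) :
    Measurable fun w : EuclideanSpace ℝ (Fin n) × EuclideanSpace ℝ (Fin n) =>
      ENNReal.ofReal (Real.exp (-2 * Real.pi * a * (inner ℝ w.1 w.2 + ψ' w.2))) := by
  have : Measurable fun w : EuclideanSpace ℝ (Fin n) × EuclideanSpace ℝ (Fin n) =>
      inner ℝ w.1 w.2 := (continuous_inner (𝕜 := ℝ)).measurable
  have h : Measurable fun w : EuclideanSpace ℝ (Fin n) × EuclideanSpace ℝ (Fin n) => ψ' w.2 :=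
    hψ'.comp measurable_snd
  fun_prop

/-- Nothing is known of `ψ` off `B`, while Tonelli requires a weight measurable on the whole space.
-/
theorem exists_measurable_eqOn (hB : MeasurableSet B) (hψ : ContinuousOn ψ B) :
    ∃ ψ' : EuclideanSpace ℝ (Fin n) → ℝ, Measurable ψ' ∧ Set.EqOn ψ' ψ B := by
  classical
  exact ⟨B.piecewise ψ 0, hψ.measurable_piecewise continuousOn_const hB,
    fun y hy => Set.piecewise_eq_of_mem _ _ _ hy⟩

theorem measurableSet_weightSet (hB : MeasurableSet B) (hψ : ContinuousOn ψ B) {α : ℝ≥0∞}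
    (hα : α ≠ ∞) : MeasurableSet (weightSet B ψ α) := by
  obtain ⟨ψ', hψ'm, hψ'⟩ := exists_measurable_eqOn hB hψ
  rw [weightSet, if_neg hα]
  refine measurableSet_lt ?_ measurable_const
  have h := (measurable_weight hψ'm α.toReal).lintegral_prod_right' (ν := volume.restrict B)
  convert h using 2 with t
  exact setLIntegral_congr_fun hB fun y hy => by simp only [hψ' hy]

/-- A function of finite mixed norm vanishes almost everywhere outside `U_{sp}` when
`s p ≤ q`. -/
theorem ae_mem_weightSet_of_mixedNorm_lt_top (hB : MeasurableSet B) (hψ : ContinuousOn ψ B)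
    (hf : Measurable f) {p q : ℝ} (hp : 0 < p) (hq : 0 < q) {s α : ℝ≥0∞} (hs : 0 < s)
    (hst : s ≠ ∞) (hα : α ≠ ∞) (hαs : α.toReal = s.toReal * p) (hspq : s.toReal * p ≤ q)
    (hfin : mixedNorm B ψ p q s f < ∞) : ∀ᵐ t, f t ≠ 0 → t ∈ weightSet B ψ α := by
  obtain ⟨ψ', hψ'm, hψ'⟩ := exists_measurable_eqOn hB hψ
  have hs0 : 0 < s.toReal := ENNReal.toReal_pos hs.ne' hst
  set r := s.toReal * p / q with hr
  have hr0 : 0 < r := by positivity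
  have hr1 : r ≤ 1 := by rw [hr, div_le_one hq]; exact hspq
  rw [mixedNorm, if_neg hst, ENNReal.rpow_lt_top_iff_of_pos (by positivity)] at hfin
  -- Sets of finite measure on which `|f| ≥ 1/(m + 1)`; they exhaust `{f ≠ 0}`.
  set A : ℕ → Set (EuclideanSpace ℝ (Fin n)) := fun m =>
    {t | 1 ≤ (m + 1 : ℝ≥0∞) * ‖f t‖ₑ} ∩ Metric.ball 0 m with hA
  have hAm : ∀ m, MeasurableSet (A m) := fun m =>
    (measurableSet_le measurable_const (hf.enorm.const_mul _)).inter measurableSet_ball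
  have hAfin : ∀ m, volume (A m) ≠ ∞ := fun m =>
    ((measure_mono Set.inter_subset_right).trans_lt measure_ball_lt_top).ne
  set W : EuclideanSpace ℝ (Fin n) → EuclideanSpace ℝ (Fin n) → ℝ≥0∞ := fun t y =>
    ENNReal.ofReal (Real.exp (-2 * Real.pi * α.toReal * (inner ℝ t y + ψ' y))) with hW
  have hWm : Measurable (Function.uncurry W) := measurable_weight hψ'm α.toReal
  have hAae : ∀ m, ∀ᵐ t, t ∈ A m → t ∈ weightSet B ψ α := by
    intro m
    set C : ℝ≥0∞ := volume (A m) ^ (1 - r) * ((m + 1 : ℝ≥0∞) ^ q) ^ r with hC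
    have hCt : C ≠ ∞ := ENNReal.mul_ne_top (ENNReal.rpow_ne_top_of_nonneg (by linarith) (hAfin m))
      (ENNReal.rpow_ne_top_of_nonneg hr0.le (ENNReal.rpow_ne_top_of_nonneg hq.le (by finiteness)))
    have hle : ∀ y ∈ B, ∫⁻ t in A m, W t y ≤ C * (∫⁻ t, (‖f t‖ₑ *
        ENNReal.ofReal (Real.exp (-2 * Real.pi * (inner ℝ y t + ψ y)))) ^ q) ^ r := by
      intro y hy
      set E : EuclideanSpace ℝ (Fin n) → ℝ≥0∞ := fun t =>
        ENNReal.ofReal (Real.exp (-2 * Real.pi * (inner ℝ y t + ψ y))) ^ q with hE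
      have hEm : Measurable E := by
        refine Measurable.pow_const (ENNReal.measurable_ofReal.comp ?_) q
        exact (Continuous.measurable (by fun_prop))
      have hWE : ∀ t, W t y = E t ^ r := fun t => by
        simp only [hW, hE]
        rw [← ENNReal.rpow_mul, ENNReal.ofReal_rpow_of_pos (Real.exp_pos _),
          ← Real.exp_mul, hψ' hy, real_inner_comm, hαs, hr, mul_div_cancel₀ _ hq.ne']
        congr 2
        ring
      simp only [hWE]
      -- The weight defining `U_{sp}` is `E^r` with `r = sp/q ≤ 1`. Hölder pulls `r` outside the
      -- integral over `A m`, where inserting `((m + 1)|f|)^q ≥ 1` produces the inner integral of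
      -- the mixed norm.
      refine (lintegral_rpow_le_measure_rpow_mul hr0 hr1 hEm.aemeasurable).trans ?_
      rw [Measure.restrict_apply_univ, hC, mul_assoc, ← ENNReal.mul_rpow_of_nonneg _ _ hr0.le]
      gcongr
      rw [← lintegral_const_mul' _ _ (ENNReal.rpow_ne_top_of_nonneg hq.le (by finiteness))]
      refine (setLIntegral_mono' (hAm m) fun t ht => ?_).trans (setLIntegral_le_lintegral (A m) _)
      rw [hE, ENNReal.mul_rpow_of_nonneg _ _ hq.le, ← mul_assoc,
        ← ENNReal.mul_rpow_of_nonneg _ _ hq.le]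
      exact le_mul_of_one_le_left zero_le (ENNReal.one_le_rpow ht.1 hq)
    have hfin2 : ∫⁻ t in A m, ∫⁻ y in B, W t y < ∞ := by
      rw [lintegral_lintegral_swap hWm.aemeasurable]
      refine (setLIntegral_mono' hB hle).trans_lt ?_
      rw [lintegral_const_mul' _ _ hCt]
      exact ENNReal.mul_lt_top hCt.lt_top hfin
    have hae := ae_lt_top (hWm.lintegral_prod_right' (ν := volume.restrict B)) hfin2.ne
    rw [ae_restrict_iff' (hAm m)] at hae
    filter_upwards [hae] with t ht htA
    rw [weightSet, if_neg hα]
    refine lt_of_eq_of_lt ?_ (ht htA)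
    exact setLIntegral_congr_fun hB fun y hy => by simp only [Function.uncurry, hW, hψ' hy]
  filter_upwards [ae_all_iff.2 hAae] with t ht hft
  have h0 : 0 < ‖f t‖ := norm_pos_iff.2 hft
  obtain ⟨m, hm⟩ := exists_nat_gt (max ‖f t‖⁻¹ ‖t‖)
  refine ht m ⟨?_, ?_⟩
  · rw [Set.mem_ofPred_eq, ← ofReal_norm, ← Nat.cast_add_one, ← ENNReal.ofReal_natCast,
      ← ENNReal.ofReal_mul (by positivity), ENNReal.one_le_ofReal]
    have := (le_max_left _ _).trans hm.le
    rw [inv_le_iff_one_le_mul₀ h0] at this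
    push_cast
    nlinarith
  · rw [mem_ball_zero_iff]
    exact (le_max_right _ _).trans_lt hm

end Weights
end TubeBergman

/-! ### The main theorem -/

open TubeBergman

theorem theorem1 {n : ℕ} (B : Set (EuclideanSpace ℝ (Fin n))) (hBo : IsOpen B)
    (hBc : IsConnected B) (ψ : EuclideanSpace ℝ (Fin n) → ℝ) (hψ : ContinuousOn ψ B)
    (p : ℝ) (hp1 : 1 ≤ p) (hp2 : p ≤ 2) (s : ℝ≥0∞) (hs : 0 < s)
    (F : EuclideanSpace ℂ (Fin n) → ℂ) (hF : F ∈ bergmanSpace B ψ p s) :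
    ∃ f : EuclideanSpace ℝ (Fin n) → ℂ,
      (∀ z ∈ tube B,
        Integrable (fun t => f t * Complex.exp (2 * Real.pi * Complex.I * dot t z)) ∧
        F z = ∫ t, f t * Complex.exp (2 * Real.pi * Complex.I * dot t z)) ∧
      (p = 1 →
        Continuous f ∧
        (∀ t, ‖f t‖ₑ * weightNorm B ψ s t ≤ bergmanNorm B ψ 1 s F) ∧
        Function.support f ⊆ weightSet B ψ s) ∧
      (1 < p →
        Measurable f ∧
        (∀ q : ℝ, 1 / p + 1 / q = 1 → mixedNorm B ψ p q s f ≤ bergmanNorm B ψ p s F) ∧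
        (s * ENNReal.ofReal (p - 1) ≤ 1 →
          Function.support f ⊆ weightSet B ψ (s * ENNReal.ofReal p))) := by
  obtain ⟨hFd, hFn⟩ := hF
  have hp0 : 0 < p := by linarith
  obtain ⟨r, hr, hrp, hloc⟩ := exists_lintegral_slice_rpow_lt_top hBo hψ hp1 hs hFn
  have hbd : ∀ y₀ ∈ B, ∃ δ > 0, ∃ M : ℝ, Metric.ball y₀ δ ⊆ B ∧
      ∀ y ∈ Metric.ball y₀ δ, ∀ x, ‖F (cpoint x y)‖ ≤ M := by
    intro y₀ hy₀
    obtain ⟨ρ, hρ, hsub, hfin⟩ := hloc y₀ hy₀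
    obtain ⟨M, hM⟩ := exists_norm_slice_le hBo hFd hp1 hr hrp hρ hsub hfin
    exact ⟨ρ / 2, by positivity, M, (Metric.ball_subset_ball (by linarith)).trans hsub, hM⟩
  set S : Set (EuclideanSpace ℝ (Fin n)) := {y ∈ B | ∫⁻ x, ‖F (cpoint x y)‖ₑ ^ p < ∞}
  have hSB : S ⊆ B := fun y hy => hy.1
  have hS : B ⊆ closure S := by
    intro y hy
    refine Metric.mem_closure_iff.2 fun ε hε => ?_
    obtain ⟨ρ, hρ, hsub, hfin⟩ := hloc y hy
    obtain ⟨y', hy', hfin'⟩ := exists_slice_lt_top hr hρ (lt_min hρ hε) hfin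
    refine ⟨y', ⟨hsub (Metric.ball_subset_ball (min_le_left _ _) hy'), hfin'⟩, ?_⟩
    rw [dist_comm]
    exact Metric.ball_subset_ball (min_le_right _ _) hy'
  rcases hp1.eq_or_lt with rfl | hp1'
  · have hSi : ∀ y ∈ S, Integrable fun x => F (cpoint x y) := fun y hy => by
      refine ⟨(continuous_slice hFd.continuousOn hy.1).aestronglyMeasurable, ?_⟩
      have := hy.2
      simp only [ENNReal.rpow_one] at this
      exact this
    obtain ⟨f, hfc, hfb, hrep⟩ := exists_continuous_representation hBo hBc.isPreconnected hFd hbd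
      hSB hS hBc.nonempty hSi
    have hkey : ∀ t, ∀ y ∈ B, ‖f t‖ₑ * ENNReal.ofReal (Real.exp (-(2 * Real.pi * inner ℝ t y))) ≤
        ∫⁻ x, ‖F (cpoint x y)‖ₑ := by
      intro t y hy
      -- For `y ∉ S` the right-hand side is infinite, so the estimate holds on all of `B`.
      rcases eq_or_ne (∫⁻ x, ‖F (cpoint x y)‖ₑ) ∞ with h | h
      · rw [h]; exact le_top
      · have hyS : y ∈ S := ⟨hy, by simpa only [ENNReal.rpow_one] using h.lt_top⟩
        rw [← ofReal_integral_norm_eq_lintegral_enorm (hSi y hyS), ← ofReal_norm,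
          ← ENNReal.ofReal_mul (norm_nonneg _)]
        refine ENNReal.ofReal_le_ofReal ?_
        rw [Real.exp_neg, ← div_eq_mul_inv, div_le_iff₀ (Real.exp_pos _), mul_comm]
        exact hfb y hyS t
    have hle : ∀ t, ‖f t‖ₑ * weightNorm B ψ s t ≤ bergmanNorm B ψ 1 s F := fun t =>
      enorm_mul_weightNorm_le hs hBo.measurableSet (hkey t)
    refine ⟨f, hrep, fun _ => ⟨hfc, hle, fun t ht => ?_⟩, fun h => (lt_irrefl _ h).elim⟩
    refine mem_weightSet_of_weightNorm_lt_top hs ?_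
    exact ENNReal.lt_top_of_mul_ne_top_right ((hle t).trans_lt hFn).ne (enorm_ne_zero.2 ht)
  · have hpq : p.HolderConjugate p.conjExponent := Real.HolderConjugate.conjExponent hp1'
    set q := p.conjExponent
    have hq0 : 0 < q := hpq.symm.pos
    obtain ⟨f, hfm, hfb, hrep⟩ := exists_measurable_representation hBo hBc.isPreconnected hFd hbd
      hpq hp2 hSB hS hBc.nonempty fun y hy => hy.2
    have hkey : ∀ y ∈ B, eLpNorm (fun t => (Real.exp (-(2 * Real.pi * inner ℝ t y)) : ℂ) * f t)
        (ENNReal.ofReal q) volume ≤ (∫⁻ x, ‖F (cpoint x y)‖ₑ ^ p) ^ (1 / p) := by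
      intro y hy
      rcases eq_or_ne (∫⁻ x, ‖F (cpoint x y)‖ₑ ^ p) ∞ with h | h
      · rw [h, ENNReal.top_rpow_of_pos (by positivity)]
        exact le_top
      · rw [← eLpNorm_ofReal_eq hp0]
        exact hfb y ⟨hy, h.lt_top⟩
    have hmix : mixedNorm B ψ p q s f ≤ bergmanNorm B ψ p s F :=
      mixedNorm_le_bergmanNorm hp0 hq0 s hkey hBo.measurableSet
    have huniq : ∀ q' : ℝ, 1 / p + 1 / q' = 1 → q' = q := fun q' hq' => by
      have := hpq.inv_add_inv_eq_one
      simp only [one_div] at hq'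
      exact inv_injective (by linarith)
    by_cases hcond : s * ENNReal.ofReal (p - 1) ≤ 1
    · have hp10 : 0 < ENNReal.ofReal (p - 1) := by simpa using hp1'
      have hst : s ≠ ∞ := by
        rintro rfl
        rw [ENNReal.top_mul hp10.ne'] at hcond
        simp at hcond
      set α := s * ENNReal.ofReal p with hα
      have hαt : α ≠ ∞ := ENNReal.mul_ne_top hst ENNReal.ofReal_ne_top
      have hαs : α.toReal = s.toReal * p := by
        rw [hα, ENNReal.toReal_mul, ENNReal.toReal_ofReal hp0.le]
      -- Since `q(p - 1) = p`, multiplying by `p - 1` turns this into `p · s(p - 1) ≤ p`.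
      have hspq : s.toReal * p ≤ q := by
        have h1 := ENNReal.toReal_mono ENNReal.one_ne_top hcond
        rw [ENNReal.toReal_mul, ENNReal.toReal_ofReal (by linarith), ENNReal.toReal_one] at h1
        have h2 : q * (p - 1) = p := by
          have := hpq.mul_eq_add
          linarith
        have h3 : 0 < p - 1 := by linarith
        refine le_of_mul_le_mul_right ?_ h3
        rw [h2]
        nlinarith
      have hU := measurableSet_weightSet hBo.measurableSet hψ hαt
      have hae := ae_mem_weightSet_of_mixedNorm_lt_top hBo.measurableSet hψ hfm hp0 hq0 hs hst hαt
        hαs hspq (hmix.trans_lt hFn)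
      -- So far `f` vanishes only almost everywhere outside `U_{sp}`. The cut-off makes it vanish
      -- everywhere there, without affecting the integrals or norms.
      set f' := (weightSet B ψ α).indicator f with hf'
      have hff' : f' =ᵐ[volume] f := by
        filter_upwards [hae] with t ht
        by_cases h : t ∈ weightSet B ψ α
        · exact Set.indicator_of_mem h _
        · rw [hf', Set.indicator_of_notMem h]
          by_contra h0
          exact h (ht (Ne.symm h0))
      have hmix' : mixedNorm B ψ p q s f' ≤ bergmanNorm B ψ p s F := by
        refine mixedNorm_le_bergmanNorm hp0 hq0 s (fun y hy => ?_) hBo.measurableSet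
        refine le_trans (le_of_eq (eLpNorm_congr_ae ?_)) (hkey y hy)
        filter_upwards [hff'] with t ht
        rw [ht]
      refine ⟨f', fun z hz => ?_, fun h => (hp1'.ne' h).elim, fun _ => ⟨hfm.indicator hU,
        fun q' hq' => huniq q' hq' ▸ hmix', fun _ => Set.support_indicator_subset⟩⟩
      have h1 : (fun t => f' t * Complex.exp (2 * Real.pi * Complex.I * dot t z)) =ᵐ[volume]
          fun t => f t * Complex.exp (2 * Real.pi * Complex.I * dot t z) := by
        filter_upwards [hff'] with t ht
        rw [ht]
      rw [integral_congr_ae h1]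
      exact ⟨(hrep z hz).1.congr h1.symm, (hrep z hz).2⟩
    · exact ⟨f, hrep, fun h => (hp1'.ne' h).elim, fun _ => ⟨hfm,
        fun q' hq' => huniq q' hq' ▸ hmix, fun h => (hcond h).elim⟩⟩
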